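/- Let $W,T>0$, $\rho_W(x)=\frac{\sin Wx}{\pi x}$, and let $(\mathcal B_W\mathcal D_Tf)(t)=\int_{-T}^{T}\rho_W(t-s)f(s)\,ds$. The nonzero eigenvalues of $\mathcal B_W\mathcal D_T$ on $L^2(\mathbb R)$ are simple and are enumerated decreasingly, $\gamma_0>\gamma_1>\dots>0$. Let $\xi_n$ be a real eigenfunction, $\mathcal B_W\mathcal D_T\xi_n=\gamma_n\xi_n$ on all of $\mathbb R$, normalized by $\int_{\mathbb R}\xi_n^2=1$ (the $n$-th $W,T$-prolate). Write $\|f\|_T^2=\int_{-T}^{T}f^2$, $\|f\|_{>T}^2=\int_{|t|>T}f^2$ and $\|f\|_\infty^2=\int_{\mathbb R}f^2$ (so $\|\cdot\|_\infty$ is the $L^2(\mathbb R)$ norm). Then $0<\gamma_n<1$, $\xi_n$ is smooth with $\xi_n'\in L^2(\mathbb R)$, there is a unique $\lambda_n\in\mathbb R$ with $$(T^2-t^2)\xi_n''(t)-2t\,\xi_n'(t)+W^2(T^2-t^2)\xi_n(t)=-\lambda_n\xi_n(t)\qquad(t\in\mathbb R),$$ and $\|\xi_n'\|_\infty<W$.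 Put $$C_{\mathrm{extra},n}=\sqrt{\|\xi_n'\|_\infty^2-\tfrac{\lambda_n}{T}\tfrac{\xi_n(T)^2}{1-\gamma_n}},\quad C_{\mathrm{intra},n}=\sqrt{\|\xi_n'\|_\infty^2+\tfrac{\lambda_n}{T}\tfrac{\xi_n(T)^2}{\gamma_n}},$$ $$\tilde C_{\mathrm{intra},n}=C_{\mathrm{intra},n}+\delta_{n0}\tfrac{\xi_0(T)^2}{\gamma_0},\quad C_n=\sqrt{\|\xi_n'\|_\infty^2+\tfrac{\lambda_n^2}{4T^2}}.$$ The following hold. 1. $\|\xi_n'\|_T^2=\gamma_n\,C_{\mathrm{intra},n}^2$ and $\|\xi_n'\|_{>T}^2=(1-\gamma_n)\,C_{\mathrm{extra},n}^2$. 2. $\sup_{|t|\ge T}\xi_n(t)^2\le(1-\gamma_n)\,C_{\mathrm{extra},n}$ and $\sup_{|t|\le T}\xi_n(t)^2\le\gamma_n\,\tilde C_{\mathrm{intra},n}$. 3. If $\lambda_n<0$, then $C_{\mathrm{extra},n}\le C_n-\frac{\lambda_n}{2T}$, $C_{\mathrm{extra},n}\le W\bigl(\sqrt{1+c^2/4}+c/2\bigr)$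 with $c=WT$, and $C_{\mathrm{intra},n}<\|\xi_n'\|_\infty<W$. If $\lambda_n\ge0$, then $C_{\mathrm{extra},n}\le\|\xi_n'\|_\infty<W$ and $C_{\mathrm{intra},n}\le C_n+\frac{\lambda_n}{2T}$. 4. There are absolute constants $K$ and $c_0>0$ such that for all $W,T>0$ with $c=WT\ge c_0$ and all $n$ with $\lambda_n<0$, $C_{\mathrm{extra},n}<W\bigl(c+c^{-1}+Kc^{-2}\bigr)$. -/

import Mathlib

open MeasureTheory
open scoped ContDiff

/-- The sampling function `ρ_W(x) = sin (W x) / (π x)`, with value `W / π` at `x = 0`. -/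
noncomputable def samplingKernel (W x : ℝ) : ℝ := W / Real.pi * Real.sinc (W * x)

/-- The operator `B_W D_T` (truncation to `[-T, T]` followed by band limiting to `[-W, W]`):
`(B_W D_T f)(t) = ∫_{-T}^{T} ρ_W(t - s) f(s) ds`. -/
noncomputable def bandTimeLimit (W T : ℝ) (f : ℝ → ℝ) (t : ℝ) : ℝ :=
  ∫ s in (-T)..T, samplingKernel W (t - s) * f s

/-- `f` is a nonzero square integrable eigenfunction of `B_W D_T` with nonzero eigenvalue `γ`.
The equation is imposed at every point, which selects the smooth representative. -/
def IsProlateEigenfunction (W T γ : ℝ) (f : ℝ → ℝ) : Prop :=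
  γ ≠ 0 ∧ MemLp f 2 volume ∧ f ≠ 0 ∧ ∀ t : ℝ, bandTimeLimit W T f t = γ * f t

/-- `ξ` is an `n`-th `W,T`-prolate, normalized in `L²(ℝ)`, with eigenvalue `γ = γ_n`: it is an
eigenfunction of `B_W D_T` whose eigenvalue is preceded by exactly `n` larger ones. (The nonzero
eigenvalues are simple, so that they are enumerated as `γ_0 > γ_1 > γ_2 > ⋯ > 0`.) -/
def IsProlate (W T : ℝ) (n : ℕ) (γ : ℝ) (ξ : ℝ → ℝ) : Prop :=
  IsProlateEigenfunction W T γ ξ ∧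
  (∫ t : ℝ, ξ t ^ 2) = 1 ∧
  {γ' : ℝ | γ < γ' ∧ ∃ f : ℝ → ℝ, IsProlateEigenfunction W T γ' f}.encard = n

/-- The prolate spheroidal differential operator
`P_{WT} y = (T² - t²) y'' - 2 t y' + W² (T² - t²) y`. -/
noncomputable def prolateDiffOp (W T : ℝ) (y : ℝ → ℝ) (t : ℝ) : ℝ :=
  (T ^ 2 - t ^ 2) * deriv (deriv y) t - 2 * t * deriv y t + W ^ 2 * (T ^ 2 - t ^ 2) * y t

/-- `y` solves the prolate spheroidal wave equation `P_{WT} y = -lam y` on the real line. -/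
def SolvesPSWEq (W T lam : ℝ) (y : ℝ → ℝ) : Prop :=
  ∀ t : ℝ, prolateDiffOp W T y t = -lam * y t

/-- `‖f‖_T²`, the energy of `f` on `[-T, T]`. -/
noncomputable def energyInside (T : ℝ) (f : ℝ → ℝ) : ℝ := ∫ t in (-T)..T, f t ^ 2

/-- `‖f‖_{>T}²`, the energy of `f` on `{|t| > T}`. -/
noncomputable def energyOutside (T : ℝ) (f : ℝ → ℝ) : ℝ := ∫ t in {t : ℝ | T < |t|}, f t ^ 2

/-- `‖f‖_∞`, which here denotes the `L²` norm of `f` on the whole real line. -/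
noncomputable def lineNorm (f : ℝ → ℝ) : ℝ := Real.sqrt (∫ t : ℝ, f t ^ 2)

/-- `C_extra = √(‖ξ'‖_∞² - (λ / T) ξ(T)² / (1 - γ))`. -/
noncomputable def CExtra (T γ lam : ℝ) (ξ : ℝ → ℝ) : ℝ :=
  Real.sqrt (lineNorm (deriv ξ) ^ 2 - lam / T * (ξ T ^ 2 / (1 - γ)))

/-- `C_intra = √(‖ξ'‖_∞² + (λ / T) ξ(T)² / γ)`. -/
noncomputable def CIntra (T γ lam : ℝ) (ξ : ℝ → ℝ) : ℝ :=
  Real.sqrt (lineNorm (deriv ξ) ^ 2 + lam / T * (ξ T ^ 2 / γ))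

/-- `C̃_intra = C_intra + δ_{n0} ξ(T)² / γ`. -/
noncomputable def CIntraTilde (T : ℝ) (n : ℕ) (γ lam : ℝ) (ξ : ℝ → ℝ) : ℝ :=
  CIntra T γ lam ξ + if n = 0 then ξ T ^ 2 / γ else 0

/-- `C_n = √(‖ξ'‖_∞² + λ² / (4 T²))`. -/
noncomputable def CBase (T lam : ℝ) (ξ : ℝ → ℝ) : ℝ :=
  Real.sqrt (lineNorm (deriv ξ) ^ 2 + lam ^ 2 / (4 * T ^ 2))

/-! Everything is read off two descriptions of an eigenfunction ξ. The kernel ρ_W is a Fourier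
integral of a constant over [-W, W], so ξ is a constant times the band-limited function whose
spectrum is that of ξ truncated to [-T, T]. Pairings over [-T, T] and Plancherel on ℝ then lead to
the same spectral integrals, up to a factor γ: the inner energy of ξ is γ, and the integral of ξ ξ''
over [-T, T] is -γ‖ξ'‖². The second description is the prolate equation, which at the singular point
T reads ξ'(T) = λ ξ(T) / (2T). Integrating ξ ξ'' by parts produces the boundary term (λ/T) ξ(T)²,
and this is the formula for the derivative energies.

The equation holds because the differential operator P commutes with B_W D_T and the nonzero
eigenvalues are simple. Simplicity is a boundary phenomenon: differentiation is skew on the spectral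
side, so within one eigenspace the boundary terms of integration by parts must cancel. Hence P
preserves the eigenfunctions of a given parity that vanish at T. As P lowers the order of vanishing
at T by exactly one, such functions are zero (`eq_zero_of_apply_eq_zero`).

The supremum bounds are the fundamental theorem of calculus for ξ² with Cauchy–Schwarz, started at
infinity outside [-T, T] and at a zero of ξ inside. For n ≥ 1 a zero exists because ξ is orthogonal
to a positive top eigenfunction (`exists_positive_top_eigenfunction`). A Perron–Frobenius argument
gives positivity only while 2WT ≤ π, where the kernel is nonnegative; continuity in W carries it to
all W, the good band widths being open and relatively closed in (0, ∞).

The bounds on the constants are self-improving: the supremum bound at T, inserted into the formula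
for C², is a quadratic inequality for C. The estimate -λ ≤ W²T² makes the outer bound explicit. -/

section Plancherel

/-! ### Plancherel's theorem on L¹ ∩ L². -/

open FourierTransform SchwartzMap

/-- The `L²` Fourier transform of an integrable function is given by the Fourier integral. -/
theorem Lp.fourier_toLp_ae_eq {g : ℝ → ℂ} (hg : Integrable g) (hg2 : MemLp g 2 volume) :
    (𝓕 (hg2.toLp g) : Lp ℂ 2 (volume : Measure ℝ)) =ᵐ[volume] 𝓕 g := by
  have hcont : Continuous (𝓕 g) :=
    VectorFourier.fourierIntegral_continuous Real.continuous_fourierChar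
      (by exact continuous_inner) hg
  refine ae_eq_of_integral_contDiff_smul_eq
    ((Lp.memLp (𝓕 (hg2.toLp g) : Lp ℂ 2 (volume : Measure ℝ))).locallyIntegrable
      (by norm_num)) hcont.locallyIntegrable ?_
  intro φ hφ hφc
  have hφ' : HasCompactSupport (fun x => (φ x : ℂ)) := hφc.comp_left Complex.ofReal_zero
  let ψ : 𝓢(ℝ, ℂ) := hφ'.toSchwartzMap (Complex.ofRealCLM.contDiff.comp hφ)
  have hψ : ∀ x, ψ x = (φ x : ℂ) := fun x => rfl
  -- The L² transform agrees with the distributional one, which moves the transform onto the test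
  -- function; the multiplication formula for integrable functions moves it back onto `g`.
  have h := congrArg (fun F : 𝓢'(ℝ, ℂ) => F ψ)
    (Lp.fourier_toTemperedDistribution_eq (hg2.toLp g))
  simp only [TemperedDistribution.fourier_apply] at h
  rw [Lp.toTemperedDistribution_apply, Lp.toTemperedDistribution_apply] at h
  simp only [hψ] at h
  have e1 : ∫ x, φ x • (𝓕 (hg2.toLp g) : Lp ℂ 2 (volume : Measure ℝ)) x =
      ∫ x, (φ x : ℂ) • (𝓕 (hg2.toLp g) : Lp ℂ 2 (volume : Measure ℝ)) x := by
    simp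
  rw [e1, ← h]
  have e2 : ∫ x, (𝓕 ψ) x • (hg2.toLp g : ℝ → ℂ) x = ∫ x, (𝓕 (ψ : ℝ → ℂ)) x • g x := by
    refine integral_congr_ae ?_
    filter_upwards [hg2.coeFn_toLp] with x hx
    rw [hx, SchwartzMap.fourier_coe]
  rw [e2]
  have e3 := VectorFourier.integral_fourierIntegral_smul_eq_flip (L := innerₗ ℝ)
    (μ := (volume : Measure ℝ)) (ν := (volume : Measure ℝ)) (f := (ψ : ℝ → ℂ)) (g := g)
    Real.continuous_fourierChar continuous_inner ψ.integrable hg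
  have e4 : (innerₗ ℝ : ℝ →ₗ[ℝ] ℝ →ₗ[ℝ] ℝ).flip = innerₗ ℝ := by ext; simp
  rw [e4] at e3
  refine e3.trans ?_
  simp only [hψ]
  simp
  rfl

theorem memLp_two_fourier {g : ℝ → ℂ} (hg : Integrable g) (hg2 : MemLp g 2 volume) :
    MemLp (𝓕 g) 2 volume :=
  (memLp_congr_ae (Lp.fourier_toLp_ae_eq hg hg2)).1 (Lp.memLp _)

/-- **Plancherel's theorem** for functions in `L¹ ∩ L²`. -/
theorem integral_norm_sq_fourier {g : ℝ → ℂ} (hg : Integrable g) (hg2 : MemLp g 2 volume) :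
    ∫ x, ‖𝓕 g x‖ ^ 2 = ∫ x, ‖g x‖ ^ 2 := by
  have key : ∀ f : Lp ℂ 2 (volume : Measure ℝ), ‖f‖ ^ 2 = ∫ x, ‖f x‖ ^ 2 := by
    intro f
    have h := L2.inner_def (𝕜 := ℂ) f f
    rw [inner_self_eq_norm_sq_to_K] at h
    simp only [inner_self_eq_norm_sq_to_K] at h
    have h2 : ((‖f‖ ^ 2 : ℝ) : ℂ) = ((∫ x, ‖f x‖ ^ 2 : ℝ) : ℂ) := by
      rw [← integral_complex_ofReal]
      push_cast
      exact h
    exact_mod_cast h2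
  have h1 := key (𝓕 (hg2.toLp g))
  rw [Lp.norm_fourier_eq, key] at h1
  have h2 : ∫ x, ‖(hg2.toLp g : ℝ → ℂ) x‖ ^ 2 = ∫ x, ‖g x‖ ^ 2 := by
    refine integral_congr_ae ?_
    filter_upwards [hg2.coeFn_toLp] with x hx
    rw [hx]
  have h3 : ∫ x, ‖(𝓕 (hg2.toLp g) : Lp ℂ 2 (volume : Measure ℝ)) x‖ ^ 2 = ∫ x, ‖𝓕 g x‖ ^ 2 := by
    refine integral_congr_ae ?_
    filter_upwards [Lp.fourier_toLp_ae_eq hg hg2] with x hx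
    rw [hx]
  rw [← h3, ← h1, h2]

end Plancherel

/-! ### Parameter integrals and band-limited functions. -/

/-- Differentiation under an interval integral with continuous data. -/
theorem hasDerivAt_intervalIntegral_of_continuous {𝕜 : Type*} [RCLike 𝕜] {E : Type*}
    [NormedAddCommGroup E] [NormedSpace ℝ E] [NormedSpace 𝕜 E] {K K' : 𝕜 → ℝ → E} {a b : ℝ}
    (hK : Continuous (Function.uncurry K)) (hK' : Continuous (Function.uncurry K'))
    (h : ∀ z s, HasDerivAt (fun z => K z s) (K' z s) z) (z : 𝕜) :
    HasDerivAt (fun z => ∫ s in a..b, K z s) (∫ s in a..b, K' z s) z := by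
  obtain ⟨C, hC⟩ := ((isCompact_closedBall z 1).prod
    (isCompact_uIcc (a := a) (b := b))).exists_bound_of_continuousOn hK'.continuousOn
  have hc : ∀ {K : 𝕜 → ℝ → E}, Continuous (Function.uncurry K) → ∀ x, Continuous (K x) :=
    fun h x => h.comp (by fun_prop : Continuous fun s => (x, s))
  refine (intervalIntegral.hasDerivAt_integral_of_dominated_loc_of_deriv_le (F := K) (F' := K')
    (bound := fun _ => C) (s := Metric.closedBall z 1) (Metric.closedBall_mem_nhds z one_pos)
    (Filter.Eventually.of_forall fun x => (hc hK x).aestronglyMeasurable)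
    ((hc hK z).intervalIntegrable _ _) (hc hK' z).aestronglyMeasurable
    (Filter.Eventually.of_forall fun t ht x hx => hC (x, t) ⟨hx, Set.uIoc_subset_uIcc ht⟩)
    intervalIntegrable_const
    (Filter.Eventually.of_forall fun t ht x hx => h x t)).2

theorem intervalIntegral_swap_of_continuous {E : Type*} [NormedAddCommGroup E] [NormedSpace ℝ E]
    {F : ℝ → ℝ → E} (hF : Continuous (Function.uncurry F)) (a b c d : ℝ) :
    ∫ x in a..b, ∫ y in c..d, F x y = ∫ y in c..d, ∫ x in a..b, F x y :=
  intervalIntegral_intervalIntegral_swap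
    ((hF.continuousOn.integrableOn_compact (isCompact_uIcc.prod isCompact_uIcc)).mono_set
      (Set.prod_mono Set.uIoc_subset_uIcc Set.uIoc_subset_uIcc))

/-- The function with spectrum `a` on the band `[-W, W]`. -/
noncomputable def bandSynthesis (W : ℝ) (a : ℝ → ℂ) (z : ℂ) : ℂ :=
  ∫ w in (-W)..W, a w * Complex.exp (Complex.I * w * z)

theorem hasDerivAt_bandSynthesis (W : ℝ) {a : ℝ → ℂ} (ha : Continuous a) (z : ℂ) :
    HasDerivAt (bandSynthesis W a) (bandSynthesis W (fun w => Complex.I * w * a w) z) z := by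
  refine hasDerivAt_intervalIntegral_of_continuous (𝕜 := ℂ) (K' := fun z w =>
    Complex.I * w * a w * Complex.exp (Complex.I * w * z)) ?_ ?_ ?_ z
  · unfold Function.uncurry; fun_prop
  · unfold Function.uncurry; fun_prop
  · intro z w
    have h1 : HasDerivAt (fun z : ℂ => Complex.I * w * z) (Complex.I * w) z := by
      simpa using (hasDerivAt_id z).const_mul (Complex.I * w)
    refine (h1.cexp.const_mul (a w)).congr_deriv ?_
    ring

theorem analyticAt_bandSynthesis (W : ℝ) {a : ℝ → ℂ} (ha : Continuous a) (z : ℂ) :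
    AnalyticAt ℂ (bandSynthesis W a) z :=
  (show Differentiable ℂ (bandSynthesis W a) from
    fun z => (hasDerivAt_bandSynthesis W ha z).differentiableAt).analyticAt z

-- The argument is rescaled by -1/(2π) because the Fourier integral uses the kernel exp(-2πi x y),
-- whereas the synthesis uses exp(i w t).
open FourierTransform in
theorem bandSynthesis_eq_fourier {W : ℝ} (hW : 0 < W) (a : ℝ → ℂ) (t : ℝ) :
    bandSynthesis W a t = 𝓕 ((Set.Ioc (-W) W).indicator a) (-(2 * Real.pi)⁻¹ * t) := by
  rw [bandSynthesis, intervalIntegral.integral_of_le (by linarith), Real.fourier_real_eq_integral_exp_smul,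
    ← integral_indicator measurableSet_Ioc]
  congr 1 with w
  by_cases h : w ∈ Set.Ioc (-W) W
  · simp only [Set.indicator_of_mem h, smul_eq_mul]
    rw [mul_comm]
    congr 2
    push_cast
    have : (Real.pi : ℂ) ≠ 0 := by exact_mod_cast Real.pi_ne_zero
    field_simp
  · simp [Set.indicator_of_notMem h]

theorem integrable_indicator_band (W : ℝ) {a : ℝ → ℂ} (ha : Continuous a) :
    Integrable ((Set.Ioc (-W) W).indicator a) :=
  (ha.integrableOn_Ioc).integrable_indicator measurableSet_Ioc

theorem memLp_indicator_band (W : ℝ) {a : ℝ → ℂ} (ha : Continuous a) :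
    MemLp ((Set.Ioc (-W) W).indicator a) 2 volume := by
  rw [memLp_indicator_iff_restrict measurableSet_Ioc]
  obtain ⟨C, hC⟩ := (isCompact_Icc (a := -W) (b := W)).exists_bound_of_continuousOn ha.continuousOn
  refine MemLp.of_bound ha.aestronglyMeasurable C ?_
  filter_upwards [ae_restrict_mem measurableSet_Ioc] with x hx
  exact hC x ⟨hx.1.le, hx.2⟩

theorem memLp_bandSynthesis {W : ℝ} (hW : 0 < W) {a : ℝ → ℂ} (ha : Continuous a) :
    MemLp (fun t : ℝ => bandSynthesis W a t) 2 volume := by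
  have hF := memLp_two_fourier (integrable_indicator_band W ha) (memLp_indicator_band W ha)
  have hc : Continuous (fun t : ℝ => bandSynthesis W a t) :=
    (continuous_iff_continuousAt.2 fun z => (hasDerivAt_bandSynthesis W ha z).continuousAt).comp
      Complex.continuous_ofReal
  rw [memLp_two_iff_integrable_sq_norm hF.1] at hF
  rw [memLp_two_iff_integrable_sq_norm hc.aestronglyMeasurable]
  simp only [bandSynthesis_eq_fourier hW]
  exact hF.comp_mul_left' (R := -(2 * Real.pi)⁻¹) (by simp [Real.pi_ne_zero])

theorem integral_norm_sq_bandSynthesis {W : ℝ} (hW : 0 < W) {a : ℝ → ℂ} (ha : Continuous a) :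
    ∫ t : ℝ, ‖bandSynthesis W a t‖ ^ 2 = 2 * Real.pi * ∫ w in (-W)..W, ‖a w‖ ^ 2 := by
  simp only [bandSynthesis_eq_fourier hW]
  rw [Measure.integral_comp_mul_left
      (fun x => ‖FourierTransform.fourier ((Set.Ioc (-W) W).indicator a) x‖ ^ 2),
    integral_norm_sq_fourier (integrable_indicator_band W ha) (memLp_indicator_band W ha),
    intervalIntegral.integral_of_le (by linarith), ← integral_indicator measurableSet_Ioc]
  have : (fun x => ‖(Set.Ioc (-W) W).indicator a x‖ ^ 2) =
      (Set.Ioc (-W) W).indicator (fun x => ‖a x‖ ^ 2) := by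
    ext x
    by_cases h : x ∈ Set.Ioc (-W) W <;> simp [h]
  rw [this]
  simp [abs_of_pos Real.pi_pos]

/-- The Fourier transform of the truncation of `f` to `[-T, T]`. -/
noncomputable def timeSpectrum (T : ℝ) (f : ℝ → ℝ) (w : ℝ) : ℂ :=
  ∫ s in (-T)..T, (f s : ℂ) * Complex.exp (-(Complex.I * w * s))

theorem continuous_timeSpectrum (T : ℝ) {f : ℝ → ℝ} (hf : Continuous f) :
    Continuous (timeSpectrum T f) :=
  intervalIntegral.continuous_parametric_intervalIntegral_of_continuous' (by fun_prop) _ _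

/-- The source of smoothness of the kernel, including at the removable singularity 0, and of the
spectral form of `bandTimeLimit`. -/
theorem samplingKernel_eq_bandSynthesis (W x : ℝ) :
    (samplingKernel W x : ℂ) = (2 * Real.pi : ℂ)⁻¹ * bandSynthesis W (fun _ => 1) x := by
  have hpi : (Real.pi : ℂ) ≠ 0 := by exact_mod_cast Real.pi_ne_zero
  rcases eq_or_ne x 0 with rfl | hx
  · simp [samplingKernel, bandSynthesis]
    field_simp
    ring
  · have h := intervalIntegral.integral_comp_mul_right (a := -W) (b := W)
      (fun t : ℝ => Complex.exp (t * Complex.I)) hx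
    rw [neg_mul, integral_exp_mul_I_eq_sinc] at h
    have h2 : bandSynthesis W (fun _ => 1) x =
        ∫ t in (-W)..W, Complex.exp (((t * x : ℝ) : ℂ) * Complex.I) := by
      rw [bandSynthesis]
      congr 1 with t
      rw [one_mul]
      congr 1
      push_cast
      ring
    rw [h2, h, samplingKernel]
    have hx' : (x : ℂ) ≠ 0 := by exact_mod_cast hx
    simp only [Complex.real_smul]
    push_cast
    field_simp

/-- Real functions given by a band synthesis are analytic, and are differentiated on the spectral
side. -/
theorem analyticAt_of_eq_bandSynthesis {W : ℝ} {a : ℝ → ℂ} (ha : Continuous a) {g : ℝ → ℝ} {c : ℂ}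
    (hg : ∀ t : ℝ, (g t : ℂ) = c * bandSynthesis W a t) (t : ℝ) : AnalyticAt ℝ g t := by
  have h1 : AnalyticAt ℝ (fun z : ℂ => c * bandSynthesis W a z) (Complex.ofRealCLM t) :=
    (analyticAt_const.mul (analyticAt_bandSynthesis W ha _)).restrictScalars
  have h2 : AnalyticAt ℝ (fun t : ℝ => c * bandSynthesis W a (Complex.ofRealCLM t)) t :=
    AnalyticAt.comp (g := fun z : ℂ => c * bandSynthesis W a z) h1 (Complex.ofRealCLM.analyticAt t)
  have h3 := (Complex.reCLM.analyticAt _).comp h2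
  refine h3.congr (Filter.Eventually.of_forall fun s => ?_)
  simp [← hg]

theorem deriv_of_eq_bandSynthesis {W : ℝ} {a : ℝ → ℂ} (ha : Continuous a) {g : ℝ → ℝ} {c : ℂ}
    (hg : ∀ t : ℝ, (g t : ℂ) = c * bandSynthesis W a t) (t : ℝ) :
    ((deriv g t : ℝ) : ℂ) = c * bandSynthesis W (fun w => Complex.I * w * a w) t := by
  have h1 := ((hasDerivAt_bandSynthesis W ha t).const_mul c).comp_ofReal
  simp only [← hg] at h1
  exact (analyticAt_of_eq_bandSynthesis ha hg t).differentiableAt.hasDerivAt.ofReal_comp.unique h1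

theorem contDiff_of_eq_bandSynthesis {W : ℝ} {a : ℝ → ℂ} (ha : Continuous a) {g : ℝ → ℝ} {c : ℂ}
    (hg : ∀ t : ℝ, (g t : ℂ) = c * bandSynthesis W a t) : ContDiff ℝ ∞ g :=
  contDiff_iff_contDiffAt.2 fun t => (analyticAt_of_eq_bandSynthesis ha hg t).contDiffAt

theorem contDiff_samplingKernel (W : ℝ) : ContDiff ℝ ∞ (samplingKernel W) :=
  contDiff_of_eq_bandSynthesis continuous_const (samplingKernel_eq_bandSynthesis W)

theorem continuous_samplingKernel (W : ℝ) : Continuous (samplingKernel W) :=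
  (contDiff_samplingKernel W).continuous

theorem hasDerivAt_of_contDiff {f : ℝ → ℝ} (hf : ContDiff ℝ ∞ f) (x : ℝ) :
    HasDerivAt f (deriv f x) x :=
  (hf.differentiable (by simp) x).hasDerivAt

theorem contDiff_deriv {f : ℝ → ℝ} (hf : ContDiff ℝ ∞ f) : ContDiff ℝ ∞ (deriv f) :=
  (contDiff_infty_iff_deriv.1 hf).2

/-! ### The sampling kernel and the commuting differential operator. -/

theorem samplingKernel_neg (W x : ℝ) : samplingKernel W (-x) = samplingKernel W x := by
  simp [samplingKernel]

theorem abs_samplingKernel_le {W : ℝ} (hW : 0 ≤ W) (x : ℝ) :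
    |samplingKernel W x| ≤ W / Real.pi := by
  rw [samplingKernel, abs_mul, abs_of_nonneg (div_nonneg hW Real.pi_pos.le)]
  exact mul_le_of_le_one_right (div_nonneg hW Real.pi_pos.le) (Real.abs_sinc_le_one _)

theorem mul_samplingKernel (W x : ℝ) : x * samplingKernel W x = Real.sin (W * x) / Real.pi := by
  have hpi := Real.pi_ne_zero
  rcases eq_or_ne (W * x) 0 with h | h
  · rcases mul_eq_zero.1 h with h | h <;> simp [samplingKernel, h]
  · rw [samplingKernel, Real.sinc_of_ne_zero h]
    have := left_ne_zero_of_mul h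
    have := right_ne_zero_of_mul h
    field_simp

/-- The differential equation of the sampling function. -/
theorem samplingKernel_ode (W x : ℝ) :
    x * deriv (deriv (samplingKernel W)) x + 2 * deriv (samplingKernel W) x
      + W ^ 2 * x * samplingKernel W x = 0 := by
  have hk := contDiff_samplingKernel W
  have hlin : ∀ x : ℝ, HasDerivAt (fun x => W * x) W x := fun x => by
    simpa using (hasDerivAt_id x).const_mul W
  -- The equation says that u = xρ_W(x) = sin(Wx)/π satisfies u'' + W²u = 0; this is its first
  -- derivative.
  have h1 : ∀ x, samplingKernel W x + x * deriv (samplingKernel W) x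
      = Real.cos (W * x) * W / Real.pi := by
    intro x
    have e1 := (hasDerivAt_id' x).mul (hasDerivAt_of_contDiff hk x)
    have e2 := (hlin x).sin.div_const Real.pi
    have e3 : ((fun x => x) * samplingKernel W) = fun x => Real.sin (W * x) / Real.pi :=
      funext (mul_samplingKernel W)
    rw [e3] at e1
    linarith [e1.unique e2]
  have e1 := (hasDerivAt_of_contDiff hk x).add
    ((hasDerivAt_id' x).mul (hasDerivAt_of_contDiff (contDiff_deriv hk) x))
  have e2 := ((hlin x).cos.mul_const W).div_const Real.pi
  have e3 : (samplingKernel W + (fun x => x) * deriv (samplingKernel W)) =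
      fun x => Real.cos (W * x) * W / Real.pi := funext h1
  rw [e3] at e1
  have e4 := e1.unique e2
  have e5 := mul_samplingKernel W x
  linear_combination e4 + W ^ 2 * e5

/-- Only integrability of `f` is assumed, since this is what first upgrades a square integrable
eigenfunction to a continuous one. -/
theorem continuous_bandTimeLimit {W T : ℝ} (hW : 0 ≤ W) {f : ℝ → ℝ}
    (hf : IntervalIntegrable f volume (-T) T) : Continuous (bandTimeLimit W T f) := by
  refine intervalIntegral.continuous_of_dominated_interval (bound := fun s => W / Real.pi * |f s|)
    (fun t => ?_) (fun t => Filter.Eventually.of_forall fun s _ => ?_) (hf.abs.const_mul _)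
    (Filter.Eventually.of_forall fun s _ => ?_)
  · exact (((continuous_samplingKernel W).comp
      (continuous_const.sub continuous_id)).aestronglyMeasurable).mul
      hf.def'.aestronglyMeasurable
  · rw [Real.norm_eq_abs, abs_mul]
    exact mul_le_mul_of_nonneg_right (abs_samplingKernel_le hW _) (abs_nonneg _)
  · exact ((continuous_samplingKernel W).comp (continuous_id.sub continuous_const)).mul
      continuous_const

theorem bandTimeLimit_eq_bandSynthesis (W T : ℝ) {f : ℝ → ℝ} (hf : Continuous f) (t : ℝ) :
    (bandTimeLimit W T f t : ℂ) =
      (2 * Real.pi : ℂ)⁻¹ * bandSynthesis W (timeSpectrum T f) t := by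
  have h1 : (bandTimeLimit W T f t : ℂ) = ∫ s in (-T)..T, ∫ w in (-W)..W,
      (2 * Real.pi : ℂ)⁻¹ * (f s * Complex.exp (-(Complex.I * w * s))
        * Complex.exp (Complex.I * w * t)) := by
    rw [bandTimeLimit, ← intervalIntegral.integral_ofReal]
    congr 1 with s
    push_cast
    rw [samplingKernel_eq_bandSynthesis, bandSynthesis, mul_assoc, mul_comm _ (f s : ℂ),
      ← intervalIntegral.integral_const_mul, ← intervalIntegral.integral_const_mul]
    congr 1 with w
    rw [mul_assoc (f s : ℂ), ← Complex.exp_add, one_mul]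
    congr 2
    push_cast
    ring_nf
  rw [h1, intervalIntegral_swap_of_continuous
    (by unfold Function.uncurry; fun_prop), bandSynthesis, ← intervalIntegral.integral_const_mul]
  congr 1 with w
  rw [intervalIntegral.integral_const_mul, timeSpectrum, intervalIntegral.integral_mul_const]

/-- Pairing a band synthesis with a function on `[-T, T]`, on the spectral side. -/
theorem integral_mul_bandSynthesis (W T : ℝ) {g : ℝ → ℝ} (hg : Continuous g) {b : ℝ → ℂ}
    (hb : Continuous b) :
    ∫ t in (-T)..T, (g t : ℂ) * bandSynthesis W b t =
      ∫ w in (-W)..W, b w * (starRingEnd ℂ) (timeSpectrum T g w) := by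
  have h1 : ∀ t : ℝ, (g t : ℂ) * bandSynthesis W b t =
      ∫ w in (-W)..W, (g t : ℂ) * (b w * Complex.exp (Complex.I * w * t)) := fun t => by
    rw [intervalIntegral.integral_const_mul, bandSynthesis]
  simp only [h1]
  rw [intervalIntegral_swap_of_continuous (by unfold Function.uncurry; fun_prop)]
  congr 1 with w
  have h2 : (starRingEnd ℂ) (timeSpectrum T g w) =
      ∫ s in (-T)..T, (starRingEnd ℂ) ((g s : ℂ) * Complex.exp (-(Complex.I * w * s))) := by
    simp only [timeSpectrum, intervalIntegral, map_sub, integral_conj]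
  rw [h2, ← intervalIntegral.integral_const_mul]
  congr 1 with t
  simp only [map_mul, Complex.conj_ofReal, ← Complex.exp_conj, map_neg, Complex.conj_I]
  ring_nf

theorem hasDerivAt_integral_comp_sub_mul {k f : ℝ → ℝ} (hk : ContDiff ℝ ∞ k) (hf : Continuous f)
    (a b t : ℝ) :
    HasDerivAt (fun t => ∫ s in a..b, k (t - s) * f s) (∫ s in a..b, deriv k (t - s) * f s) t := by
  have hk0 := hk.continuous
  have hk1 := (contDiff_deriv hk).continuous
  refine hasDerivAt_intervalIntegral_of_continuous (𝕜 := ℝ) (K := fun t s => k (t - s) * f s)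
    (K' := fun t s => deriv k (t - s) * f s)
    (by unfold Function.uncurry; fun_prop) (by unfold Function.uncurry; fun_prop) ?_ t
  intro z s
  simpa using ((hasDerivAt_of_contDiff hk (z - s)).comp_sub_const z s).mul_const (f s)

/-- The prolate differential operator commutes with `B_W D_T`. -/
theorem prolateDiffOp_bandTimeLimit (W T : ℝ) {f : ℝ → ℝ} (hf : ContDiff ℝ ∞ f) (t : ℝ) :
    prolateDiffOp W T (bandTimeLimit W T f) t = bandTimeLimit W T (prolateDiffOp W T f) t := by
  have hk := contDiff_samplingKernel W
  have hk' := contDiff_deriv hk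
  have hf' := contDiff_deriv hf
  have d1 : deriv (bandTimeLimit W T f) =
      fun t => ∫ s in (-T)..T, deriv (samplingKernel W) (t - s) * f s :=
    funext fun t => (hasDerivAt_integral_comp_sub_mul hk hf.continuous _ _ t).deriv
  have d2 : deriv (deriv (bandTimeLimit W T f)) t =
      ∫ s in (-T)..T, deriv (deriv (samplingKernel W)) (t - s) * f s := by
    rw [d1]
    exact (hasDerivAt_integral_comp_sub_mul hk' hf.continuous _ _ t).deriv
  have c0 := hk.continuous
  have c1 := hk'.continuous
  have c2 := (contDiff_deriv hk').continuous
  have f0 := hf.continuous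
  have f1 := hf'.continuous
  have f2 := (contDiff_deriv hf').continuous
  have hI : ∀ u : ℝ → ℝ, Continuous u → IntervalIntegrable u volume (-T) T :=
    fun u hu => hu.intervalIntegrable _ _
  rw [prolateDiffOp, d2, d1, bandTimeLimit, bandTimeLimit]
  simp only
  -- Lagrange's identity for P in the variable s: the weight T² - s² kills the boundary terms at ±T.
  -- What remains is P acting in t minus P acting in s on ρ_W(t - s), which equals -(t + s) times
  -- the left side of the kernel's equation.
  have hG : ∀ s : ℝ, HasDerivAt (fun s => (T ^ 2 - s ^ 2) *
      (samplingKernel W (t - s) * deriv f s + deriv (samplingKernel W) (t - s) * f s))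
      (-(2 * s) * (samplingKernel W (t - s) * deriv f s + deriv (samplingKernel W) (t - s) * f s)
       + (T ^ 2 - s ^ 2) * (samplingKernel W (t - s) * deriv (deriv f) s
        - deriv (deriv (samplingKernel W)) (t - s) * f s)) s := by
    intro s
    have q0 : HasDerivAt (fun s : ℝ => t - s) (-1) s := by
      simpa using (hasDerivAt_id s).const_sub t
    have q1 := (hasDerivAt_of_contDiff hk (t - s)).comp s q0
    have q2 := (hasDerivAt_of_contDiff hk' (t - s)).comp s q0
    have q3 : HasDerivAt (fun s : ℝ => T ^ 2 - s ^ 2) (-(2 * s)) s := by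
      simpa using (hasDerivAt_pow 2 s).const_sub (T ^ 2)
    refine (q3.mul ((q1.mul (hasDerivAt_of_contDiff hf' s)).add
      (q2.mul (hasDerivAt_of_contDiff hf s)))).congr_deriv ?_
    simp only [Function.comp, Pi.add_apply, Pi.mul_apply]
    ring
  have hzero := intervalIntegral.integral_eq_sub_of_hasDerivAt (a := -T) (b := T)
    (fun s _ => hG s) (hI _ (by fun_prop))
  have hr : ∀ X Y : ℝ, (T ^ 2 - T ^ 2) * X - (T ^ 2 - (-T) ^ 2) * Y = 0 := fun X Y => by ring
  rw [hr] at hzero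
  have hc : Continuous (prolateDiffOp W T f) := by unfold prolateDiffOp; fun_prop
  rw [← sub_eq_zero, ← neg_eq_zero, neg_sub, ← hzero]
  rw [← intervalIntegral.integral_const_mul, ← intervalIntegral.integral_const_mul,
    ← intervalIntegral.integral_const_mul, ← intervalIntegral.integral_sub (hI _ (by fun_prop))
    (hI _ (by fun_prop)), ← intervalIntegral.integral_add (hI _ (by fun_prop))
    (hI _ (by fun_prop)), ← sub_eq_zero, ← intervalIntegral.integral_sub (hI _ (by fun_prop))
    (hI _ (by fun_prop)), ← intervalIntegral.integral_sub (hI _ (by fun_prop))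
    (hI _ (by fun_prop))]
  rw [← intervalIntegral.integral_zero (a := -T) (b := T) (μ := volume)]
  congr 1 with s
  have ho := samplingKernel_ode W (t - s)
  simp only [prolateDiffOp]
  linear_combination ((t + s) * f s) * ho

/-! ### Orders of vanishing under the prolate operator. -/

/-- `f` agrees near `a` with `(t - a) ^ k * u t` for some analytic `u` with `u a = c`. -/
def HasLeadingTerm (f : ℝ → ℝ) (a : ℝ) (k : ℕ) (c : ℝ) : Prop :=
  ∃ u : ℝ → ℝ, AnalyticAt ℝ u a ∧ u a = c ∧ f =ᶠ[nhds a] fun t => (t - a) ^ k * u t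

namespace HasLeadingTerm

variable {f g : ℝ → ℝ} {a c d : ℝ} {k : ℕ}

theorem deriv (h : HasLeadingTerm f a (k + 1) c) :
    HasLeadingTerm (deriv f) a k ((k + 1) * c) := by
  obtain ⟨u, hu, rfl, hf⟩ := h
  refine ⟨fun t => (k + 1) * u t + (t - a) * _root_.deriv u t, ?_, by simp, ?_⟩
  · have := hu.deriv
    fun_prop
  · filter_upwards [hf.deriv, hu.eventually_analyticAt] with t ht hut
    rw [ht]
    have h1 : HasDerivAt (fun t => (t - a) ^ (k + 1)) ((k + 1) * (t - a) ^ k) t := by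
      simpa using! ((hasDerivAt_id t).sub_const a).pow (k + 1)
    have h2 : HasDerivAt (fun t => (t - a) ^ (k + 1) * u t) _ t :=
      h1.mul hut.differentiableAt.hasDerivAt
    rw [h2.deriv]
    ring

theorem analytic_mul {p : ℝ → ℝ} (hp : AnalyticAt ℝ p a) (h : HasLeadingTerm f a k c) :
    HasLeadingTerm (fun t => p t * f t) a k (p a * c) := by
  obtain ⟨u, hu, rfl, hf⟩ := h
  refine ⟨fun t => p t * u t, by fun_prop, rfl, ?_⟩
  filter_upwards [hf] with t ht
  rw [ht]
  ring

theorem sub_mul (h : HasLeadingTerm f a k c) :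
    HasLeadingTerm (fun t => (t - a) * f t) a (k + 1) c := by
  obtain ⟨u, hu, rfl, hf⟩ := h
  refine ⟨u, hu, rfl, ?_⟩
  filter_upwards [hf] with t ht
  rw [ht]
  ring

/-- The coefficient of a leading term may be zero, so a term of higher order can be demoted and
added to one of lower order. -/
theorem lower (h : HasLeadingTerm f a (k + 1) c) : HasLeadingTerm f a k 0 := by
  obtain ⟨u, hu, rfl, hf⟩ := h
  refine ⟨fun t => (t - a) * u t, by fun_prop, by simp, ?_⟩
  filter_upwards [hf] with t ht
  rw [ht]
  ring

theorem add (hf : HasLeadingTerm f a k c) (hg : HasLeadingTerm g a k d) :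
    HasLeadingTerm (fun t => f t + g t) a k (c + d) := by
  obtain ⟨u, hu, rfl, hf⟩ := hf
  obtain ⟨v, hv, rfl, hg⟩ := hg
  refine ⟨fun t => u t + v t, by fun_prop, rfl, ?_⟩
  filter_upwards [hf, hg] with t h1 h2
  rw [h1, h2]
  ring

theorem unique (h : HasLeadingTerm f a k c) (h' : HasLeadingTerm f a k d) : c = d := by
  obtain ⟨u, hu, rfl, hf⟩ := h
  obtain ⟨v, hv, rfl, hg⟩ := h'
  have h1 : u =ᶠ[nhdsWithin a {a}ᶜ] v := by
    filter_upwards [nhdsWithin_le_nhds (hf.symm.trans hg), self_mem_nhdsWithin] with t ht hne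
    exact mul_left_cancel₀ (pow_ne_zero k (sub_ne_zero.2 hne)) ht
  exact tendsto_nhds_unique_of_eventuallyEq
    (hu.continuousAt.tendsto.mono_left nhdsWithin_le_nhds)
    (hv.continuousAt.tendsto.mono_left nhdsWithin_le_nhds) h1

theorem congr (h : HasLeadingTerm f a k c) (hc : c = d) : HasLeadingTerm f a k d := hc ▸ h

theorem apply_eq (h : HasLeadingTerm f a 0 c) : f a = c := by
  obtain ⟨u, -, rfl, hf⟩ := h
  simpa using hf.eq_of_nhds

end HasLeadingTerm

theorem exists_hasLeadingTerm {f : ℝ → ℝ} {a : ℝ} (hf : AnalyticAt ℝ f a)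
    (h : ¬ ∀ᶠ t in nhds a, f t = 0) : ∃ k c, c ≠ 0 ∧ HasLeadingTerm f a k c := by
  obtain ⟨n, g, hg, hne, h⟩ := hf.exists_eventuallyEq_pow_smul_nonzero_iff.2 h
  exact ⟨n, g a, hne, g, hg, rfl, h.mono fun t ht => by simpa using ht⟩

theorem prolateDiffOp_eq (W T : ℝ) {f : ℝ → ℝ} (hf : ContDiff ℝ ∞ f) :
    prolateDiffOp W T f = fun t =>
      deriv (fun s => (T ^ 2 - s ^ 2) * deriv f s) t + W ^ 2 * (T ^ 2 - t ^ 2) * f t := by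
  ext t
  have q : HasDerivAt (fun s : ℝ => T ^ 2 - s ^ 2) (-(2 * t)) t := by
    simpa using (hasDerivAt_pow 2 t).const_sub (T ^ 2)
  have q' : HasDerivAt (fun s => (T ^ 2 - s ^ 2) * deriv f s) _ t :=
    q.mul (hasDerivAt_of_contDiff (contDiff_deriv hf) t)
  rw [q'.deriv, prolateDiffOp]
  ring

/-- At the singular point `T` the prolate operator lowers the order of vanishing by one. -/
theorem HasLeadingTerm.prolateDiffOp_singular {W T : ℝ} {f : ℝ → ℝ} (hf : ContDiff ℝ ∞ f) {k : ℕ}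
    {c : ℝ} (h : HasLeadingTerm f T (k + 1) c) :
    HasLeadingTerm (prolateDiffOp W T f) T k (-(2 * T) * (k + 1) ^ 2 * c) := by
  rw [prolateDiffOp_eq W T hf]
  have h1 := (h.deriv.sub_mul.analytic_mul (p := fun t => -(t + T)) (by fun_prop)).deriv
  have h2 := (h.analytic_mul (p := fun t => W ^ 2 * (T ^ 2 - t ^ 2)) (by fun_prop)).lower
  -- The simple zero of T² - s² at T restores one of the two orders lost to differentiation; each
  -- derivative contributes a factor k + 1.
  have e : (fun s => (T ^ 2 - s ^ 2) * _root_.deriv f s) =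
      fun t => -(t + T) * ((t - T) * _root_.deriv f t) := by ext s; ring
  rw [e]
  exact (h1.add h2).congr (by ring)

/-- At a regular point the prolate operator lowers the order of vanishing by two. -/
theorem HasLeadingTerm.prolateDiffOp_regular {W T a : ℝ} {f : ℝ → ℝ} (hf : ContDiff ℝ ∞ f) {k : ℕ}
    {c : ℝ} (h : HasLeadingTerm f a (k + 2) c) :
    HasLeadingTerm (prolateDiffOp W T f) a k ((T ^ 2 - a ^ 2) * (k + 1) * (k + 2) * c) := by
  rw [prolateDiffOp_eq W T hf]
  have h1 := (h.deriv.analytic_mul (p := fun t => T ^ 2 - t ^ 2) (by fun_prop)).deriv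
  have h2 := (h.analytic_mul (p := fun t => W ^ 2 * (T ^ 2 - t ^ 2)) (by fun_prop)).lower.lower
  exact (h1.add h2).congr (by push_cast; ring)

/-! ### Eigenspaces and their boundary identities. -/

/-- A continuous solution of `B_W D_T f = γ f` on the real line. -/
structure IsBandTimeEigen (W T γ : ℝ) (f : ℝ → ℝ) : Prop where
  cont : Continuous f
  eq : ∀ t, bandTimeLimit W T f t = γ * f t

theorem IsProlateEigenfunction.isBandTimeEigen {W T γ : ℝ} {f : ℝ → ℝ} (hW : 0 < W)
    (h : IsProlateEigenfunction W T γ f) : IsBandTimeEigen W T γ f := by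
  obtain ⟨hγ, hf, -, heq⟩ := h
  have hi : IntervalIntegrable f volume (-T) T :=
    (hf.locallyIntegrable (by norm_num)).integrableOn_isCompact isCompact_uIcc |>.intervalIntegrable
  have e : f = fun t => γ⁻¹ * bandTimeLimit W T f t := by
    ext t
    rw [heq, inv_mul_cancel_left₀ hγ]
  exact ⟨by rw [e]; exact continuous_const.mul (continuous_bandTimeLimit hW.le hi), heq⟩

/-- `f` is even (`ε = 1`) or odd (`ε = -1`). -/
def HasParity (ε : ℝ) (f : ℝ → ℝ) : Prop := ∀ t, f (-t) = ε * f t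

namespace IsBandTimeEigen

variable {W T γ : ℝ} {f g : ℝ → ℝ}

theorem eq_bandSynthesis (hγ : γ ≠ 0) (h : IsBandTimeEigen W T γ f) (t : ℝ) :
    (f t : ℂ) = (2 * Real.pi * γ : ℂ)⁻¹ * bandSynthesis W (timeSpectrum T f) t := by
  have h1 := bandTimeLimit_eq_bandSynthesis W T h.cont t
  rw [h.eq] at h1
  have : (γ : ℂ) ≠ 0 := by exact_mod_cast hγ
  rw [mul_inv_rev, mul_assoc, ← h1]
  push_cast
  field_simp

theorem analyticAt (hγ : γ ≠ 0) (h : IsBandTimeEigen W T γ f) (t : ℝ) : AnalyticAt ℝ f t :=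
  analyticAt_of_eq_bandSynthesis (continuous_timeSpectrum T h.cont) (h.eq_bandSynthesis hγ) t

theorem contDiff (hγ : γ ≠ 0) (h : IsBandTimeEigen W T γ f) : ContDiff ℝ ∞ f :=
  contDiff_of_eq_bandSynthesis (continuous_timeSpectrum T h.cont) (h.eq_bandSynthesis hγ)

theorem deriv_eq_bandSynthesis (hγ : γ ≠ 0) (h : IsBandTimeEigen W T γ f) (t : ℝ) :
    ((deriv f t : ℝ) : ℂ) = (2 * Real.pi * γ : ℂ)⁻¹ *
      bandSynthesis W (fun w => Complex.I * w * timeSpectrum T f w) t :=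
  deriv_of_eq_bandSynthesis (continuous_timeSpectrum T h.cont) (h.eq_bandSynthesis hγ) t

theorem continuous_spectrum_deriv (h : IsBandTimeEigen W T γ f) :
    Continuous fun w : ℝ => Complex.I * w * timeSpectrum T f w := by
  have := continuous_timeSpectrum T h.cont
  fun_prop

theorem deriv_deriv_eq_bandSynthesis (hγ : γ ≠ 0) (h : IsBandTimeEigen W T γ f) (t : ℝ) :
    ((deriv (deriv f) t : ℝ) : ℂ) = (2 * Real.pi * γ : ℂ)⁻¹ *
      bandSynthesis W (fun w => Complex.I * w * (Complex.I * w * timeSpectrum T f w)) t :=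
  deriv_of_eq_bandSynthesis h.continuous_spectrum_deriv (h.deriv_eq_bandSynthesis hγ) t

theorem eq_zero_of_eventuallyEq (hγ : γ ≠ 0) (h : IsBandTimeEigen W T γ f) {a : ℝ}
    (ha : ∀ᶠ t in nhds a, f t = 0) : f = 0 :=
  AnalyticOnNhd.eq_of_eventuallyEq (fun t _ => h.analyticAt hγ t) (fun _ _ => analyticAt_const) ha

/-- Zero is admitted as an eigenfunction, so for fixed γ these form a vector space; it is stable
under reflection and, if γ ≠ 0, under P. -/
theorem smul (c : ℝ) (h : IsBandTimeEigen W T γ f) : IsBandTimeEigen W T γ (fun t => c * f t) := by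
  refine ⟨continuous_const.mul h.cont, fun t => ?_⟩
  have := h.eq t
  unfold bandTimeLimit at this ⊢
  rw [mul_left_comm, ← this, ← intervalIntegral.integral_const_mul]
  congr 1 with s
  ring

theorem add (h : IsBandTimeEigen W T γ f) (h' : IsBandTimeEigen W T γ g) :
    IsBandTimeEigen W T γ (fun t => f t + g t) := by
  refine ⟨h.cont.add h'.cont, fun t => ?_⟩
  have c := continuous_samplingKernel W
  have c1 := h.cont
  have c2 := h'.cont
  rw [mul_add, ← h.eq t, ← h'.eq t, bandTimeLimit, bandTimeLimit, bandTimeLimit,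
    ← intervalIntegral.integral_add (Continuous.intervalIntegrable (by fun_prop) _ _)
      (Continuous.intervalIntegrable (by fun_prop) _ _)]
  congr 1 with s
  ring

theorem comp_neg (h : IsBandTimeEigen W T γ f) : IsBandTimeEigen W T γ (fun t => f (-t)) := by
  refine ⟨h.cont.comp continuous_neg, fun t => ?_⟩
  have e := intervalIntegral.integral_comp_neg (a := -T) (b := T)
    (fun s => samplingKernel W (-t - s) * f s)
  rw [neg_neg] at e
  rw [← h.eq (-t), bandTimeLimit, bandTimeLimit, ← e]
  congr 1 with s
  rw [← samplingKernel_neg]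
  congr 2
  ring

theorem prolateDiffOp (hγ : γ ≠ 0) (h : IsBandTimeEigen W T γ f) :
    IsBandTimeEigen W T γ (prolateDiffOp W T f) := by
  have hf := h.contDiff hγ
  have c0 := hf.continuous
  have c1 := (contDiff_deriv hf).continuous
  have c2 := (contDiff_deriv (contDiff_deriv hf)).continuous
  refine ⟨by unfold _root_.prolateDiffOp; fun_prop, fun t => ?_⟩
  rw [← prolateDiffOp_bandTimeLimit W T hf]
  have e : bandTimeLimit W T f = fun t => γ * f t := funext h.eq
  have d : deriv (fun t => γ * f t) = fun t => γ * deriv f t := by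
    ext t
    simp
  simp only [_root_.prolateDiffOp, e, d]
  rw [show deriv (fun t => γ * deriv f t) t = γ * deriv (deriv f) t by simp]
  ring

/-- The spectral form of the pairing of `f'` with another eigenfunction. -/
theorem integral_mul_deriv (hγ : γ ≠ 0) (h : IsBandTimeEigen W T γ f) (hg : Continuous g) :
    ((∫ t in (-T)..T, g t * deriv f t : ℝ) : ℂ) = (2 * Real.pi * γ : ℂ)⁻¹ *
      ∫ w in (-W)..W, Complex.I * w * timeSpectrum T f w * (starRingEnd ℂ) (timeSpectrum T g w) := by
  rw [← integral_mul_bandSynthesis W T hg h.continuous_spectrum_deriv,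
    ← intervalIntegral.integral_const_mul, ← intervalIntegral.integral_ofReal]
  congr 1 with t
  push_cast
  rw [h.deriv_eq_bandSynthesis hγ]
  ring

theorem integral_mul_deriv_deriv (hγ : γ ≠ 0) (h : IsBandTimeEigen W T γ f) (hg : Continuous g) :
    ((∫ t in (-T)..T, g t * deriv (deriv f) t : ℝ) : ℂ) = (2 * Real.pi * γ : ℂ)⁻¹ *
      ∫ w in (-W)..W, Complex.I * w * (Complex.I * w * timeSpectrum T f w) *
        (starRingEnd ℂ) (timeSpectrum T g w) := by
  have hc := h.continuous_spectrum_deriv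
  rw [← integral_mul_bandSynthesis W T hg (by fun_prop),
    ← intervalIntegral.integral_const_mul, ← intervalIntegral.integral_ofReal]
  congr 1 with t
  push_cast
  rw [h.deriv_deriv_eq_bandSynthesis hγ]
  ring

theorem integral_mul_self (hγ : γ ≠ 0) (h : IsBandTimeEigen W T γ f) (hg : Continuous g) :
    ((∫ t in (-T)..T, g t * f t : ℝ) : ℂ) = (2 * Real.pi * γ : ℂ)⁻¹ *
      ∫ w in (-W)..W, timeSpectrum T f w * (starRingEnd ℂ) (timeSpectrum T g w) := by
  rw [← integral_mul_bandSynthesis W T hg (continuous_timeSpectrum T h.cont),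
    ← intervalIntegral.integral_const_mul, ← intervalIntegral.integral_ofReal]
  congr 1 with t
  push_cast
  rw [h.eq_bandSynthesis hγ]
  ring

/-- On the spectral side d/dt is multiplication by iw, which is skew, so the integral of g f' over
[-T, T] is antisymmetric in f and g. Its symmetrization is the boundary term of fg, which therefore
vanishes. -/
theorem boundary_mul (hγ : γ ≠ 0) (h : IsBandTimeEigen W T γ f) (h' : IsBandTimeEigen W T γ g) :
    f T * g T = f (-T) * g (-T) := by
  have e1 := h.integral_mul_deriv hγ h'.cont
  have e2 := h'.integral_mul_deriv hγ h.cont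
  have e3 : ((∫ t in (-T)..T, f t * deriv g t : ℝ) : ℂ) =
      -((∫ t in (-T)..T, g t * deriv f t : ℝ) : ℂ) := by
    rw [← Complex.conj_ofReal (∫ t in (-T)..T, g t * deriv f t), e1, e2, map_mul,
      ← intervalIntegral.intervalIntegral_conj, ← mul_neg, ← intervalIntegral.integral_neg]
    congr 1
    · rw [show (2 * Real.pi * γ : ℂ)⁻¹ = (((2 * Real.pi * γ)⁻¹ : ℝ) : ℂ) by push_cast; rfl,
        Complex.conj_ofReal]
    · congr 1 with w
      simp only [map_mul, Complex.conj_I, Complex.conj_ofReal, Complex.conj_conj]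
      ring
  have e4 : (∫ t in (-T)..T, f t * deriv g t) = -∫ t in (-T)..T, g t * deriv f t := by
    exact_mod_cast e3
  have hf := h.contDiff hγ
  have hg := h'.contDiff hγ
  have c0 := hf.continuous
  have c1 := (contDiff_deriv hf).continuous
  have d0 := hg.continuous
  have d1 := (contDiff_deriv hg).continuous
  have e5 := intervalIntegral.integral_eq_sub_of_hasDerivAt (a := -T) (b := T)
    (f := fun t => f t * g t) (f' := fun t => f t * deriv g t + g t * deriv f t)
    (fun t _ => ((hasDerivAt_of_contDiff hf t).mul (hasDerivAt_of_contDiff hg t)).congr_deriv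
      (by ring)) (Continuous.intervalIntegrable (by fun_prop) _ _)
  rw [intervalIntegral.integral_add (Continuous.intervalIntegrable (by fun_prop) _ _)
    (Continuous.intervalIntegrable (by fun_prop) _ _)] at e5
  linarith

/-- The same with the second derivative: multiplication by (iw)² = -w² is symmetric, so the boundary
term in Green's identity vanishes. -/
theorem boundary_wronskian (hγ : γ ≠ 0) (h : IsBandTimeEigen W T γ f)
    (h' : IsBandTimeEigen W T γ g) :
    deriv f T * g T - f T * deriv g T = deriv f (-T) * g (-T) - f (-T) * deriv g (-T) := by
  have e1 := h.integral_mul_deriv_deriv hγ h'.cont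
  have e2 := h'.integral_mul_deriv_deriv hγ h.cont
  have e3 : ((∫ t in (-T)..T, f t * deriv (deriv g) t : ℝ) : ℂ) =
      ((∫ t in (-T)..T, g t * deriv (deriv f) t : ℝ) : ℂ) := by
    rw [← Complex.conj_ofReal (∫ t in (-T)..T, g t * deriv (deriv f) t), e1, e2, map_mul,
      ← intervalIntegral.intervalIntegral_conj]
    congr 1
    · rw [show (2 * Real.pi * γ : ℂ)⁻¹ = (((2 * Real.pi * γ)⁻¹ : ℝ) : ℂ) by push_cast; rfl,
        Complex.conj_ofReal]
    · congr 1 with w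
      simp only [map_mul, Complex.conj_I, Complex.conj_ofReal, Complex.conj_conj]
      ring
  have e4 : (∫ t in (-T)..T, f t * deriv (deriv g) t) = ∫ t in (-T)..T, g t * deriv (deriv f) t := by
    exact_mod_cast e3
  have hf := h.contDiff hγ
  have hg := h'.contDiff hγ
  have hf' := contDiff_deriv hf
  have hg' := contDiff_deriv hg
  have c0 := hf.continuous
  have c2 := (contDiff_deriv hf').continuous
  have d0 := hg.continuous
  have d2 := (contDiff_deriv hg').continuous
  have e5 := intervalIntegral.integral_eq_sub_of_hasDerivAt (a := -T) (b := T)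
    (f := fun t => deriv f t * g t - f t * deriv g t)
    (f' := fun t => g t * deriv (deriv f) t - f t * deriv (deriv g) t)
    (fun t _ => (((hasDerivAt_of_contDiff hf' t).mul (hasDerivAt_of_contDiff hg t)).sub
      ((hasDerivAt_of_contDiff hf t).mul (hasDerivAt_of_contDiff hg' t))).congr_deriv
      (by ring)) (Continuous.intervalIntegrable (by fun_prop) _ _)
  rw [intervalIntegral.integral_sub (Continuous.intervalIntegrable (by fun_prop) _ _)
    (Continuous.intervalIntegrable (by fun_prop) _ _)] at e5
  linarith

end IsBandTimeEigen

/-! ### Parity, simplicity of the eigenvalues and the prolate equation. -/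

theorem HasParity.deriv {ε : ℝ} {f : ℝ → ℝ} (hf : HasParity ε f) : HasParity (-ε) (deriv f) := by
  intro t
  have h1 : _root_.deriv (fun s => f (-s)) t = -_root_.deriv f (-t) := deriv_comp_neg f t
  have h2 : (fun s => f (-s)) = fun s => ε * f s := funext hf
  rw [h2, deriv_const_mul_field] at h1
  linarith

theorem HasParity.prolateDiffOp {ε W T : ℝ} {f : ℝ → ℝ} (hf : HasParity ε f) :
    HasParity ε (prolateDiffOp W T f) := by
  intro t
  simp only [_root_.prolateDiffOp, hf t, hf.deriv t, hf.deriv.deriv t]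
  ring

namespace IsBandTimeEigen

variable {W T γ : ℝ} {f g : ℝ → ℝ}

/-- For f(T) = 0, the Wronskian identity for f and Pf, which have the same parity, gives
f'(T)(Pf)(T) = 0. Since (Pf)(T) = -2T f'(T), also (Pf)(T) = 0, and this iterates. A finite order k
of vanishing is impossible, because k applications of P would reduce it to order 0 with nonzero
coefficient. -/
theorem eq_zero_of_apply_eq_zero (hT : 0 < T) (hγ : γ ≠ 0) {ε : ℝ} (hε : ε * ε = 1)
    (h : IsBandTimeEigen W T γ f) (hp : HasParity ε f) (h0 : f T = 0) : f = 0 := by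
  have hinv : ∀ f, IsBandTimeEigen W T γ f → HasParity ε f → f T = 0 →
      _root_.prolateDiffOp W T f T = 0 := by
    intro f h hp h0
    have e1 : _root_.prolateDiffOp W T f T = -(2 * T) * deriv f T := by
      rw [_root_.prolateDiffOp]; ring
    by_contra hne
    have hw := h.boundary_wronskian hγ (h.prolateDiffOp hγ)
    rw [hp.deriv T, hp.prolateDiffOp T, hp T, hp.prolateDiffOp.deriv T, h0] at hw
    have h1 : deriv f T * _root_.prolateDiffOp W T f T = 0 := by
      linear_combination hw / 2 - (deriv f T * _root_.prolateDiffOp W T f T / 2) * hε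
    rcases mul_eq_zero.1 h1 with h2 | h2
    · exact hne (by rw [e1, h2, mul_zero])
    · exact hne h2
  have hord : ∀ k c f, IsBandTimeEigen W T γ f → HasParity ε f → f T = 0 →
      HasLeadingTerm f T k c → c = 0 := by
    intro k
    induction k with
    | zero =>
      intro c f _ _ h0 hl
      rw [← hl.apply_eq, h0]
    | succ k ih =>
      intro c f h hp h0 hl
      have := ih _ _ (h.prolateDiffOp hγ) hp.prolateDiffOp (hinv f h hp h0)
        (hl.prolateDiffOp_singular (h.contDiff hγ))
      have hk : (0 : ℝ) < (k + 1) ^ 2 := by positivity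
      simpa [hT.ne', hk.ne'] using this
  by_contra hne
  obtain ⟨k, c, hc, hl⟩ := exists_hasLeadingTerm (h.analyticAt hγ T)
    (fun hz => hne (h.eq_zero_of_eventuallyEq hγ hz))
  exact hc (hord k c f h hp h0 hl)

/-- For opposite parities `boundary_mul` reads f(T)g(T) = -f(T)g(T), so one of the two vanishes at
T. -/
theorem eq_zero_or_eq_zero (hT : 0 < T) (hγ : γ ≠ 0) {ε : ℝ} (hε : ε * ε = 1)
    (h : IsBandTimeEigen W T γ f) (h' : IsBandTimeEigen W T γ g) (hp : HasParity ε f)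
    (hp' : HasParity (-ε) g) : f = 0 ∨ g = 0 := by
  have hb := h.boundary_mul hγ h'
  rw [hp, hp'] at hb
  have h1 : f T * g T = 0 := by linear_combination hb / 2 - f T * g T / 2 * hε
  rcases mul_eq_zero.1 h1 with h2 | h2
  · exact .inl (h.eq_zero_of_apply_eq_zero hT hγ hε hp h2)
  · exact .inr (h'.eq_zero_of_apply_eq_zero hT hγ (by linarith) hp' h2)

/-- The even and odd parts lie in the same eigenspace and have opposite parities, so one of them is
zero. -/
theorem exists_hasParity (hT : 0 < T) (hγ : γ ≠ 0) (h : IsBandTimeEigen W T γ f) :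
    ∃ ε : ℝ, ε * ε = 1 ∧ HasParity ε f := by
  have he := h.add h.comp_neg
  have ho := h.add (h.comp_neg.smul (-1))
  rcases he.eq_zero_or_eq_zero hT hγ (ε := 1) (by norm_num) ho
    (fun t => by simp only [neg_neg]; ring) (fun t => by simp only [neg_neg]; ring) with h1 | h1
  · refine ⟨-1, by norm_num, fun t => ?_⟩
    have := congrFun h1 t
    simp only [Pi.zero_apply] at this
    linarith
  · refine ⟨1, by norm_num, fun t => ?_⟩
    have := congrFun h1 t
    simp only [Pi.zero_apply] at this
    linarith

theorem apply_ne_zero (hT : 0 < T) (hγ : γ ≠ 0) (h : IsBandTimeEigen W T γ f) (hf : f ≠ 0) :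
    f T ≠ 0 := by
  obtain ⟨ε, hε, hp⟩ := h.exists_hasParity hT hγ
  exact fun h0 => hf (h.eq_zero_of_apply_eq_zero hT hγ hε hp h0)

/-- The nonzero eigenvalues of `B_W D_T` are simple. -/
theorem exists_eq_mul (hT : 0 < T) (hγ : γ ≠ 0) (h : IsBandTimeEigen W T γ f)
    (h' : IsBandTimeEigen W T γ g) (hf : f ≠ 0) : ∃ c : ℝ, ∀ t, g t = c * f t := by
  obtain ⟨ε, hε, hp⟩ := h.exists_hasParity hT hγ
  obtain ⟨δ, hδ, hp'⟩ := h'.exists_hasParity hT hγ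
  have hfT := h.apply_ne_zero hT hγ hf
  by_cases hεδ : δ = ε
  · subst hεδ
    -- The multiple is chosen to make the difference vanish at T.
    have hd := (h'.add (h.smul (-(g T / f T)))).eq_zero_of_apply_eq_zero hT hγ hδ
      (fun t => by rw [hp, hp']; ring) (by field_simp; ring)
    refine ⟨g T / f T, fun t => ?_⟩
    have := congrFun hd t
    simp only [Pi.zero_apply] at this
    linarith
  · have hδ' : δ = -ε := by
      have : (δ - ε) * (δ + ε) = 0 := by linear_combination hδ - hε
      rcases mul_eq_zero.1 this with h1 | h1
      · exact absurd (sub_eq_zero.1 h1) hεδ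
      · linarith
    rw [hδ'] at hp'
    have hg := (h.eq_zero_or_eq_zero hT hγ hε h' hp hp').resolve_left hf
    exact ⟨0, fun t => by simp [hg]⟩

theorem exists_solvesPSWEq (hT : 0 < T) (hγ : γ ≠ 0) (h : IsBandTimeEigen W T γ f) (hf : f ≠ 0) :
    ∃ lam, SolvesPSWEq W T lam f := by
  obtain ⟨c, hc⟩ := h.exists_eq_mul hT hγ (h.prolateDiffOp hγ) hf
  exact ⟨-c, fun t => by rw [hc, neg_neg]⟩

/-- An eigenfunction that is nonnegative on `[-T, T]` is positive there. -/
theorem pos_of_nonneg (hT : 0 < T) (hγ : γ ≠ 0) (h : IsBandTimeEigen W T γ f) (hf : f ≠ 0)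
    (hn : ∀ t, |t| ≤ T → 0 ≤ f t) {t : ℝ} (ht : |t| ≤ T) : 0 < f t := by
  refine lt_of_le_of_ne (hn t ht) fun h0 => ?_
  have hTne := h.apply_ne_zero hT hγ hf
  rcases eq_or_lt_of_le ht with hte | hlt
  · rcases (abs_eq hT.le).1 hte with rfl | rfl
    · exact hTne h0.symm
    · obtain ⟨ε, hε, hp⟩ := h.exists_hasParity hT hγ
      rw [hp T] at h0
      rcases mul_eq_zero.1 h0.symm with h1 | h1
      · simp [h1] at hε
      · exact hTne h1
  · have hev : ∀ᶠ s in nhds t, |s| ≤ T := by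
      filter_upwards [continuous_abs.continuousAt.eventually_lt continuousAt_const hlt] with s hs
      exact hs.le
    have hmin : IsLocalMin f t := by
      filter_upwards [hev] with s hs
      rw [← h0]
      exact hn s hs
    have hd := hmin.deriv_eq_zero
    -- An interior zero would be a minimum, hence of some order k + 2. There P lowers the order by
    -- exactly two, while Pf = -λf still vanishes to order k + 2.
    obtain ⟨lam, hlam⟩ := h.exists_solvesPSWEq hT hγ hf
    obtain ⟨k, c, hc, hl⟩ := exists_hasLeadingTerm (h.analyticAt hγ t)
      (fun hz => hf (h.eq_zero_of_eventuallyEq hγ hz))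
    match k, hl with
    | 0, hl => exact hc (by rw [← hl.apply_eq, h0])
    | 1, hl => exact hc (by simpa [hd] using hl.deriv.apply_eq.symm)
    | k + 2, hl =>
      have h1 := hl.prolateDiffOp_regular (W := W) (T := T) (h.contDiff hγ)
      have h2 : HasLeadingTerm (_root_.prolateDiffOp W T f) t k (-lam * 0) := by
        rw [funext hlam]
        exact hl.lower.lower.analytic_mul (p := fun _ => -lam) analyticAt_const
      have h3 := h1.unique h2
      have h4 : T ^ 2 - t ^ 2 ≠ 0 := by
        have := sq_lt_sq' (abs_lt.1 hlt).1 (abs_lt.1 hlt).2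
        linarith
      have h5 : (k : ℝ) + 1 ≠ 0 := by positivity
      have h6 : (k : ℝ) + 2 ≠ 0 := by positivity
      simp [h4, h5, h6, hc] at h3

end IsBandTimeEigen

/-! ### Energies and pointwise bounds for functions of definite parity. -/

theorem memLp_of_eq_bandSynthesis {W : ℝ} (hW : 0 < W) {a : ℝ → ℂ} (ha : Continuous a) {g : ℝ → ℝ}
    {c : ℂ} (hg : ∀ t : ℝ, (g t : ℂ) = c * bandSynthesis W a t) : MemLp g 2 volume := by
  have h := ((memLp_bandSynthesis hW ha).const_mul c).re
  refine (memLp_congr_ae (Filter.Eventually.of_forall fun t => ?_)).1 h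
  simp [← hg]

theorem integral_sq_of_eq_bandSynthesis {W : ℝ} (hW : 0 < W) {a : ℝ → ℂ} (ha : Continuous a)
    {g : ℝ → ℝ} {c : ℂ} (hg : ∀ t : ℝ, (g t : ℂ) = c * bandSynthesis W a t) :
    ∫ t, g t ^ 2 = ‖c‖ ^ 2 * (2 * Real.pi * ∫ w in (-W)..W, ‖a w‖ ^ 2) := by
  rw [← integral_norm_sq_bandSynthesis hW ha, ← integral_const_mul]
  congr 1 with t
  rw [← mul_pow, ← norm_mul, ← hg, Complex.norm_real, Real.norm_eq_abs, sq_abs]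

/-- The **Cauchy–Schwarz inequality** for integrals of real functions. -/
theorem integral_abs_mul_le_sqrt_mul_sqrt {α : Type*} [MeasurableSpace α] {μ : Measure α}
    {f g : α → ℝ} (hf : MemLp f 2 μ) (hg : MemLp g 2 μ) :
    ∫ x, |f x * g x| ∂μ ≤ √(∫ x, f x ^ 2 ∂μ) * √(∫ x, g x ^ 2 ∂μ) := by
  have h := integral_mul_norm_le_Lp_mul_Lq (p := 2) (q := 2) (μ := μ) (f := f) (g := g)
    Real.HolderConjugate.two_two (by simpa using hf) (by simpa using hg)
  simpa [Real.sqrt_eq_rpow, abs_mul] using h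

theorem energyInside_add_energyOutside {T : ℝ} (hT : 0 < T) {f : ℝ → ℝ} (hf : MemLp f 2 volume) :
    energyInside T f + energyOutside T f = ∫ t, f t ^ 2 := by
  rw [energyInside, energyOutside, intervalIntegral.integral_of_le (by linarith),
    ← integral_Icc_eq_integral_Ioc, ← integral_add_compl measurableSet_Icc hf.integrable_sq]
  congr 3
  ext t
  simp [abs_le, ← not_le]

theorem energyOutside_nonneg (T : ℝ) (f : ℝ → ℝ) : 0 ≤ energyOutside T f :=
  integral_nonneg fun _ => sq_nonneg _

theorem energyInside_nonneg {T : ℝ} (hT : 0 < T) (f : ℝ → ℝ) : 0 ≤ energyInside T f :=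
  intervalIntegral.integral_nonneg (by linarith) fun _ _ => sq_nonneg _

theorem HasParity.sq_neg {ε : ℝ} (hε : ε * ε = 1) {f : ℝ → ℝ} (hf : HasParity ε f) (t : ℝ) :
    f (-t) ^ 2 = f t ^ 2 := by
  rw [hf t]
  linear_combination (f t ^ 2) * hε

theorem HasParity.sq_abs {ε : ℝ} (hε : ε * ε = 1) {f : ℝ → ℝ} (hf : HasParity ε f) (t : ℝ) :
    f |t| ^ 2 = f t ^ 2 := by
  rcases abs_choice t with h | h <;> rw [h]
  exact hf.sq_neg hε t

theorem HasParity.energyOutside_eq {T ε : ℝ} (hT : 0 < T) (hε : ε * ε = 1) {f : ℝ → ℝ}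
    (hp : HasParity ε f) :
    energyOutside T f = 2 * ∫ t in Set.Ioi T, f t ^ 2 := by
  have hm : MeasurableSet {t : ℝ | T < |t|} := measurableSet_lt measurable_const measurable_abs
  rw [energyOutside, ← integral_indicator hm, ← integral_indicator measurableSet_Ioi]
  have h := integral_comp_abs (f := (Set.Ioi T).indicator (fun t => f t ^ 2))
  have e1 : ({t : ℝ | T < |t|}.indicator fun t => f t ^ 2) =
      fun t => (Set.Ioi T).indicator (fun t => f t ^ 2) |t| := by
    ext t
    by_cases ht : T < |t|
    · rw [Set.indicator_of_mem (by exact ht), Set.indicator_of_mem (by exact ht), hp.sq_abs hε]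
    · rw [Set.indicator_of_notMem (by exact ht), Set.indicator_of_notMem (by exact ht)]
  rw [e1, h, ← integral_indicator measurableSet_Ioi, Set.indicator_indicator,
    Set.inter_eq_self_of_subset_right (Set.Ioi_subset_Ioi hT.le)]

theorem HasParity.energyInside_eq {T ε : ℝ} (hε : ε * ε = 1) {f : ℝ → ℝ}
    (hf : Continuous f) (hp : HasParity ε f) :
    energyInside T f = 2 * ∫ t in (0)..T, f t ^ 2 := by
  have h1 := intervalIntegral.integral_comp_neg (a := 0) (b := T) (fun t => f t ^ 2)
  simp only [hp.sq_neg hε, neg_zero] at h1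
  have hc : Continuous fun t => f t ^ 2 := by fun_prop
  rw [energyInside, ← intervalIntegral.integral_add_adjacent_intervals
    (hc.intervalIntegrable (-T) 0) (hc.intervalIntegrable 0 T), ← h1]
  ring

/-- A square integrable function of definite parity is bounded outside `[-T, T]` by its outer
energies. -/
theorem HasParity.sq_le_outside {T ε : ℝ} (hT : 0 < T) (hε : ε * ε = 1) {f : ℝ → ℝ}
    (hf : ContDiff ℝ ∞ f) (hp : HasParity ε f) (h2 : MemLp f 2 volume)
    (h2' : MemLp (_root_.deriv f) 2 volume) {t : ℝ} (ht : T ≤ |t|) :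
    f t ^ 2 ≤ √(energyOutside T f) * √(energyOutside T (_root_.deriv f)) := by
  rw [← hp.sq_abs hε]
  generalize |t| = t at ht
  have hd : ∀ x, HasDerivAt (fun x => f x ^ 2) (2 * (f x * _root_.deriv f x)) x := fun x =>
    ((hasDerivAt_of_contDiff hf x).pow 2).congr_deriv (by simp; ring)
  have hi : Integrable fun x => f x * _root_.deriv f x := h2.integrable_mul h2'
  have hlim := tendsto_zero_of_hasDerivAt_of_integrableOn_Ioi (a := t) (fun x _ => hd x)
    (hi.const_mul 2).integrableOn h2.integrable_sq.integrableOn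
  have h3 := integral_Ioi_of_hasDerivAt_of_tendsto (a := t) (hd t).continuousAt.continuousWithinAt
    (fun x _ => hd x) (hi.const_mul 2).integrableOn hlim
  rw [integral_const_mul] at h3
  have h4 : |∫ x in Set.Ioi t, f x * _root_.deriv f x| ≤
      ∫ x in Set.Ioi T, |f x * _root_.deriv f x| :=
    (abs_integral_le_integral_abs).trans (setIntegral_mono_set hi.abs.integrableOn
      (Filter.Eventually.of_forall fun _ => abs_nonneg _) (Set.Ioi_subset_Ioi ht).eventuallyLE)
  have h5 := integral_abs_mul_le_sqrt_mul_sqrt (h2.restrict (Set.Ioi T)) (h2'.restrict (Set.Ioi T))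
  -- By parity each half-line energy is half the outer energy, so the two factors √2 absorb the 2
  -- from (f²)' = 2ff'.
  rw [hp.energyOutside_eq hT hε, hp.deriv.energyOutside_eq hT (by linarith),
    Real.sqrt_mul zero_le_two, Real.sqrt_mul zero_le_two]
  have h6 : √2 * √2 = (2 : ℝ) := Real.mul_self_sqrt zero_le_two
  have h7 := (abs_le.1 h4).1
  have h8 : f t ^ 2 ≤ 2 * ∫ x in Set.Ioi T, |f x * _root_.deriv f x| := by linarith
  refine h8.trans ((mul_le_mul_of_nonneg_left h5 zero_le_two).trans_eq ?_)
  nth_rewrite 1 [← h6]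
  ring

/-- The oscillation of `f²` over `[-T, T]` is bounded by the inner energies, if `f` has a
definite parity. -/
theorem HasParity.sq_sub_sq_le_inside {T ε : ℝ} (hε : ε * ε = 1) {f : ℝ → ℝ}
    (hf : ContDiff ℝ ∞ f) (hp : HasParity ε f) {z t : ℝ} (hz : |z| ≤ T) (ht : |t| ≤ T) :
    f t ^ 2 - f z ^ 2 ≤ √(energyInside T f) * √(energyInside T (_root_.deriv f)) := by
  rw [← hp.sq_abs hε, ← hp.sq_abs hε z]
  have ht0 := abs_nonneg t
  have hz0 := abs_nonneg z
  generalize |t| = t at ht ht0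
  generalize |z| = z at hz hz0
  have hT : 0 ≤ T := ht0.trans ht
  have c0 := hf.continuous
  have c1 := (contDiff_deriv hf).continuous
  have hd : ∀ x, HasDerivAt (fun x => f x ^ 2) (2 * (f x * _root_.deriv f x)) x := fun x =>
    ((hasDerivAt_of_contDiff hf x).pow 2).congr_deriv (by simp; ring)
  have h3 := intervalIntegral.integral_eq_sub_of_hasDerivAt (a := z) (b := t) (fun x _ => hd x)
    (Continuous.intervalIntegrable (by fun_prop) _ _)
  rw [intervalIntegral.integral_const_mul] at h3
  have hi : IntegrableOn (fun x => |f x * _root_.deriv f x|) (Set.Ioc 0 T) :=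
    Continuous.integrableOn_Ioc (by fun_prop)
  have h4 : |∫ x in z..t, f x * _root_.deriv f x| ≤
      ∫ x in Set.Ioc 0 T, |f x * _root_.deriv f x| := by
    refine (intervalIntegral.norm_integral_le_integral_norm_uIoc (f := fun x => f x * _root_.deriv f x)).trans
      (setIntegral_mono_set hi
      (Filter.Eventually.of_forall fun _ => abs_nonneg _) (LE.le.eventuallyLE ?_))
    exact fun x hx => ⟨(le_min hz0 ht0).trans_lt hx.1, hx.2.trans (max_le hz ht)⟩
  have hm : ∀ g : ℝ → ℝ, Continuous g → MemLp g 2 (volume.restrict (Set.Ioc 0 T)) := by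
    intro g hg
    obtain ⟨C, hC⟩ := (isCompact_Icc (a := 0) (b := T)).exists_bound_of_continuousOn hg.continuousOn
    refine MemLp.of_bound hg.aestronglyMeasurable C ?_
    filter_upwards [ae_restrict_mem measurableSet_Ioc] with x hx
    exact hC x ⟨hx.1.le, hx.2⟩
  have h5 := integral_abs_mul_le_sqrt_mul_sqrt (hm f c0) (hm _ c1)
  rw [hp.energyInside_eq hε c0, hp.deriv.energyInside_eq (by linarith) c1,
    Real.sqrt_mul zero_le_two, Real.sqrt_mul zero_le_two, intervalIntegral.integral_of_le hT,
    intervalIntegral.integral_of_le hT]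
  have h6 : √2 * √2 = (2 : ℝ) := Real.mul_self_sqrt zero_le_two
  have h7 := (abs_le.1 h4).2
  have h8 : f t ^ 2 - f z ^ 2 ≤ 2 * ∫ x in Set.Ioc 0 T, |f x * _root_.deriv f x| := by linarith
  refine h8.trans ((mul_le_mul_of_nonneg_left h5 zero_le_two).trans_eq ?_)
  nth_rewrite 1 [← h6]
  ring

/-- A continuous function that is orthogonal to a positive weight has a zero. -/
theorem exists_zero_of_integral_mul_eq_zero {T : ℝ} (hT : 0 < T) {p f : ℝ → ℝ} (hp : Continuous p)
    (hf : Continuous f) (hpn : ∀ t, |t| ≤ T → 0 ≤ p t) (hp0 : 0 < p 0)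
    (h : ∫ t in (-T)..T, p t * f t = 0) : ∃ z, |z| ≤ T ∧ f z = 0 := by
  by_contra! hne
  have key : ∀ g : ℝ → ℝ, Continuous g → (∀ z, |z| ≤ T → g z ≠ 0) →
      (∫ t in (-T)..T, p t * g t = 0) → 0 < g 0 → False := by
    intro g hg hgne hgint hg0
    have hpos : ∀ z, |z| ≤ T → 0 < g z := by
      intro z hz
      by_contra! hle
      have hsub := (isPreconnected_Icc (a := -T) (b := T)).intermediate_value (a := z) (b := 0)
        (abs_le.1 hz) ⟨by linarith, hT.le⟩ hg.continuousOn
      obtain ⟨y, hy, hy0⟩ := hsub ⟨hle, hg0.le⟩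
      exact hgne y (abs_le.2 hy) hy0
    have := intervalIntegral.integral_pos (a := -T) (b := T) (f := fun t => p t * g t)
      (by linarith) (by fun_prop)
      (fun x hx => mul_nonneg (hpn x (abs_le.2 ⟨hx.1.le, hx.2⟩)) (hpos x (abs_le.2 ⟨hx.1.le, hx.2⟩)).le)
      ⟨0, ⟨by linarith, hT.le⟩, mul_pos hp0 hg0⟩
    exact this.ne' hgint
  rcases lt_or_gt_of_ne (hne 0 (by simpa using hT.le)) with h0 | h0
  · refine key (fun t => -f t) hf.neg (fun z hz => neg_ne_zero.2 (hne z hz)) ?_ (by linarith)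
    simp [h]
  · exact key f hf hne h h0

/-! ### Energy identities and eigenvalue bounds for eigenfunctions. -/

namespace IsBandTimeEigen

variable {W T γ : ℝ} {f g : ℝ → ℝ}

theorem memLp (hW : 0 < W) (hγ : γ ≠ 0) (h : IsBandTimeEigen W T γ f) : MemLp f 2 volume :=
  memLp_of_eq_bandSynthesis hW (continuous_timeSpectrum T h.cont) (h.eq_bandSynthesis hγ)

theorem memLp_deriv (hW : 0 < W) (hγ : γ ≠ 0) (h : IsBandTimeEigen W T γ f) :
    MemLp (deriv f) 2 volume :=
  memLp_of_eq_bandSynthesis hW h.continuous_spectrum_deriv (h.deriv_eq_bandSynthesis hγ)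

theorem integral_sq (hW : 0 < W) (hγ : γ ≠ 0) (h : IsBandTimeEigen W T γ f) :
    2 * Real.pi * γ ^ 2 * ∫ t, f t ^ 2 = ∫ w in (-W)..W, ‖timeSpectrum T f w‖ ^ 2 := by
  rw [integral_sq_of_eq_bandSynthesis hW (continuous_timeSpectrum T h.cont) (h.eq_bandSynthesis hγ)]
  have hpi := Real.pi_ne_zero
  simp [Real.pi_pos.le, abs_of_nonneg, mul_pow]
  field_simp

theorem integral_deriv_sq (hW : 0 < W) (hγ : γ ≠ 0) (h : IsBandTimeEigen W T γ f) :
    2 * Real.pi * γ ^ 2 * ∫ t, deriv f t ^ 2 =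
      ∫ w in (-W)..W, w ^ 2 * ‖timeSpectrum T f w‖ ^ 2 := by
  rw [integral_sq_of_eq_bandSynthesis hW h.continuous_spectrum_deriv (h.deriv_eq_bandSynthesis hγ)]
  have hpi := Real.pi_ne_zero
  simp [Real.pi_pos.le, abs_of_nonneg, mul_pow]
  field_simp

theorem energyInside_eq (hγ : γ ≠ 0) (h : IsBandTimeEigen W T γ f) :
    2 * Real.pi * γ * energyInside T f = ∫ w in (-W)..W, ‖timeSpectrum T f w‖ ^ 2 := by
  have e := h.integral_mul_self hγ h.cont
  have e1 : ∫ w in (-W)..W, timeSpectrum T f w * (starRingEnd ℂ) (timeSpectrum T f w) =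
      ((∫ w in (-W)..W, ‖timeSpectrum T f w‖ ^ 2 : ℝ) : ℂ) := by
    rw [← intervalIntegral.integral_ofReal]
    congr 1 with w
    rw [Complex.mul_conj, Complex.normSq_eq_norm_sq]
  rw [e1] at e
  have e2 : (∫ t in (-T)..T, f t * f t) =
      (2 * Real.pi * γ)⁻¹ * ∫ w in (-W)..W, ‖timeSpectrum T f w‖ ^ 2 := by exact_mod_cast e
  have hpi := Real.pi_ne_zero
  simp only [energyInside, pow_two (f _)]
  rw [e2]
  field_simp

theorem integral_mul_deriv_deriv_self (hγ : γ ≠ 0) (h : IsBandTimeEigen W T γ f) :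
    2 * Real.pi * γ * ∫ t in (-T)..T, f t * deriv (deriv f) t =
      -∫ w in (-W)..W, w ^ 2 * ‖timeSpectrum T f w‖ ^ 2 := by
  have e := h.integral_mul_deriv_deriv hγ h.cont
  have e1 : ∫ w in (-W)..W, Complex.I * w * (Complex.I * w * timeSpectrum T f w) *
        (starRingEnd ℂ) (timeSpectrum T f w) =
      ((-∫ w in (-W)..W, w ^ 2 * ‖timeSpectrum T f w‖ ^ 2 : ℝ) : ℂ) := by
    rw [← intervalIntegral.integral_neg, ← intervalIntegral.integral_ofReal]
    congr 1 with w
    have e3 := Complex.mul_conj (timeSpectrum T f w)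
    rw [Complex.normSq_eq_norm_sq] at e3
    push_cast at e3 ⊢
    rw [← e3]
    linear_combination (w ^ 2 * timeSpectrum T f w * (starRingEnd ℂ) (timeSpectrum T f w)) *
      Complex.I_sq
  rw [e1] at e
  have e2 : (∫ t in (-T)..T, f t * deriv (deriv f) t) =
      (2 * Real.pi * γ)⁻¹ * -∫ w in (-W)..W, w ^ 2 * ‖timeSpectrum T f w‖ ^ 2 := by exact_mod_cast e
  have hpi := Real.pi_ne_zero
  rw [e2]
  field_simp

/-- Plancherel on ℝ and the pairing over [-T, T] yield the same spectral integral, with prefactors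
γ² and γ respectively. -/
theorem energyInside_eq_mul (hW : 0 < W) (hγ : γ ≠ 0) (h : IsBandTimeEigen W T γ f) :
    energyInside T f = γ * ∫ t, f t ^ 2 := by
  have h1 := h.integral_sq hW hγ
  rw [← h.energyInside_eq hγ] at h1
  have hpi := Real.pi_ne_zero
  have : 2 * Real.pi * γ ≠ 0 := by positivity
  refine mul_left_cancel₀ this ?_
  linarith

theorem integral_mul_deriv_deriv_eq (hW : 0 < W) (hγ : γ ≠ 0) (h : IsBandTimeEigen W T γ f) :
    ∫ t in (-T)..T, f t * deriv (deriv f) t = -(γ * ∫ t, deriv f t ^ 2) := by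
  have h1 := h.integral_deriv_sq hW hγ
  have h2 := h.integral_mul_deriv_deriv_self hγ
  have hpi := Real.pi_ne_zero
  have : 2 * Real.pi * γ ≠ 0 := by positivity
  refine mul_left_cancel₀ this ?_
  linarith

theorem integral_sq_pos (hW : 0 < W) (hγ : γ ≠ 0) (h : IsBandTimeEigen W T γ f) (hf : f ≠ 0) :
    0 < ∫ t, f t ^ 2 := by
  obtain ⟨x, hx⟩ := Function.ne_iff.1 hf
  exact integral_pos_of_integrable_nonneg_nonzero (x := x) (h.cont.pow 2)
    (h.memLp hW hγ).integrable_sq (fun t => sq_nonneg _) (pow_ne_zero 2 hx)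

theorem gamma_pos (hW : 0 < W) (hT : 0 < T) (hγ : γ ≠ 0) (h : IsBandTimeEigen W T γ f)
    (hf : f ≠ 0) : 0 < γ := by
  have h1 := h.energyInside_eq_mul hW hγ
  have h2 := energyInside_nonneg hT f
  rw [h1] at h2
  exact lt_of_le_of_ne (nonneg_of_mul_nonneg_left h2 (h.integral_sq_pos hW hγ hf)) hγ.symm

/-- Equality would leave no energy outside [-T, T], and an analytic function vanishing on an open
set is zero. -/
theorem gamma_lt_one (hW : 0 < W) (hT : 0 < T) (hγ : γ ≠ 0) (h : IsBandTimeEigen W T γ f)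
    (hf : f ≠ 0) : γ < 1 := by
  have h1 := h.energyInside_eq_mul hW hγ
  have h2 := energyInside_add_energyOutside hT (h.memLp hW hγ)
  have h3 := h.integral_sq_pos hW hγ hf
  have h4 : 0 < energyOutside T f := by
    have ho : IsOpen {t : ℝ | T < |t|} := isOpen_lt continuous_const continuous_abs
    refine lt_of_le_of_ne (energyOutside_nonneg T f) fun h0 => hf ?_
    have h5 : (fun t => f t ^ 2) =ᵐ[volume.restrict {t : ℝ | T < |t|}] 0 :=
      (setIntegral_eq_zero_iff_of_nonneg_ae (Filter.Eventually.of_forall fun _ => sq_nonneg _)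
        (h.memLp hW hγ).integrable_sq.integrableOn).1 h0.symm
    have h6 : Set.EqOn (fun t => f t ^ 2) 0 {t : ℝ | T < |t|} :=
      Measure.eqOn_open_of_ae_eq h5 ho (h.cont.pow 2).continuousOn continuousOn_const
    refine h.eq_zero_of_eventuallyEq hγ (a := T + 1) ?_
    filter_upwards [ho.mem_nhds (show T < |T + 1| by rw [abs_of_pos (by linarith)]; linarith)]
      with t ht
    simpa using h6 ht
  nlinarith

/-- Bernstein's inequality is strict: the gap is the integral of (W² - w²) against the squared
modulus of the spectrum, which would have to vanish on the open band. -/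
theorem integral_deriv_sq_lt (hW : 0 < W) (hγ : γ ≠ 0) (h : IsBandTimeEigen W T γ f)
    (hf : f ≠ 0) : ∫ t, deriv f t ^ 2 < W ^ 2 * ∫ t, f t ^ 2 := by
  have hc := continuous_timeSpectrum T h.cont
  have h1 := h.integral_sq hW hγ
  have h2 := h.integral_deriv_sq hW hγ
  have h3 := h.integral_sq_pos hW hγ hf
  have hpi := Real.pi_pos
  have hγ2 : 0 < γ ^ 2 := by positivity
  have hpos : 0 < ∫ w in (-W)..W, (W ^ 2 - w ^ 2) * ‖timeSpectrum T f w‖ ^ 2 := by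
    refine intervalIntegral.integral_pos (by linarith) (by fun_prop) (fun x hx => ?_) ?_
    · have : x ^ 2 ≤ W ^ 2 := sq_le_sq' hx.1.le hx.2
      exact mul_nonneg (by linarith) (sq_nonneg _)
    · by_contra! hle
      have hz : Set.EqOn (timeSpectrum T f) 0 (Set.Ioo (-W) W) := by
        intro x hx
        have h4 := hle x (Set.Ioo_subset_Icc_self hx)
        have h5 : 0 < W ^ 2 - x ^ 2 := by linarith [sq_lt_sq' hx.1 hx.2]
        have h6 : ‖timeSpectrum T f x‖ ^ 2 ≤ 0 := by
          by_contra! hh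
          exact absurd (mul_pos h5 hh) (not_lt.2 h4)
        simpa using le_antisymm h6 (sq_nonneg _)
      have h7 : ∫ w in (-W)..W, ‖timeSpectrum T f w‖ ^ 2 = 0 := by
        rw [intervalIntegral.integral_of_le (by linarith), integral_Ioc_eq_integral_Ioo]
        exact setIntegral_eq_zero_of_forall_eq_zero fun x hx => by simp [hz hx]
      rw [h7] at h1
      have : 0 < 2 * Real.pi * γ ^ 2 * ∫ t, f t ^ 2 := by positivity
      exact this.ne' h1
  have e : ∫ w in (-W)..W, (W ^ 2 - w ^ 2) * ‖timeSpectrum T f w‖ ^ 2 =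
      W ^ 2 * (∫ w in (-W)..W, ‖timeSpectrum T f w‖ ^ 2) -
        ∫ w in (-W)..W, w ^ 2 * ‖timeSpectrum T f w‖ ^ 2 := by
    rw [← intervalIntegral.integral_const_mul, ← intervalIntegral.integral_sub
      (Continuous.intervalIntegrable (by fun_prop) _ _)
      (Continuous.intervalIntegrable (by fun_prop) _ _)]
    congr 1 with w
    ring
  rw [e, ← h1, ← h2] at hpos
  have : 0 < 2 * Real.pi * γ ^ 2 := by positivity
  refine lt_of_mul_lt_mul_left (a := 2 * Real.pi * γ ^ 2) ?_ this.le
  linarith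

theorem deriv_apply_eq (hT : 0 < T) {lam : ℝ} (hl : SolvesPSWEq W T lam f) :
    deriv f T = lam * f T / (2 * T) := by
  have := hl T
  rw [_root_.prolateDiffOp] at this
  field_simp
  linarith

/-- Integration by parts of ff''. By parity the boundary term is 2f(T)f'(T), and the prolate
equation at T makes it (λ/T) f(T)². -/
theorem energyInside_deriv_eq (hW : 0 < W) (hT : 0 < T) (hγ : γ ≠ 0) (h : IsBandTimeEigen W T γ f)
    {lam : ℝ} (hl : SolvesPSWEq W T lam f) :
    energyInside T (deriv f) = γ * (∫ t, deriv f t ^ 2) + lam / T * f T ^ 2 := by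
  obtain ⟨ε, hε, hp⟩ := h.exists_hasParity hT hγ
  have hf := h.contDiff hγ
  have hf' := contDiff_deriv hf
  have c0 := hf.continuous
  have c1 := hf'.continuous
  have c2 := (contDiff_deriv hf').continuous
  have e5 := intervalIntegral.integral_eq_sub_of_hasDerivAt (a := -T) (b := T)
    (f := fun t => f t * deriv f t) (f' := fun t => deriv f t ^ 2 + f t * deriv (deriv f) t)
    (fun t _ => ((hasDerivAt_of_contDiff hf t).mul (hasDerivAt_of_contDiff hf' t)).congr_deriv
      (by ring)) (Continuous.intervalIntegrable (by fun_prop) _ _)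
  rw [intervalIntegral.integral_add (Continuous.intervalIntegrable (by fun_prop) _ _)
    (Continuous.intervalIntegrable (by fun_prop) _ _), h.integral_mul_deriv_deriv_eq hW hγ,
    hp, hp.deriv, deriv_apply_eq hT hl] at e5
  have e6 : f T * (lam * f T / (2 * T)) - ε * f T * (-ε * (lam * f T / (2 * T))) =
      lam / T * f T ^ 2 := by
    have : f T * (lam * f T / (2 * T)) = lam / T * f T ^ 2 / 2 := by field_simp
    linear_combination 2 * this + f T * (lam * f T / (2 * T)) * hε
  rw [e6] at e5
  rw [energyInside]
  linarith

/-- The prolate equation in divergence form, integrated over [-T, T]. For λ ≥ 0 the weight is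
nonnegative, which forces a zero of f. -/
theorem integral_weight_mul_eq_zero (hγ : γ ≠ 0) (h : IsBandTimeEigen W T γ f)
    {lam : ℝ} (hl : SolvesPSWEq W T lam f) :
    ∫ t in (-T)..T, (W ^ 2 * (T ^ 2 - t ^ 2) + lam) * f t = 0 := by
  have hf := h.contDiff hγ
  have hf' := contDiff_deriv hf
  have c0 := hf.continuous
  have hd : ∀ t, HasDerivAt (fun s => -((T ^ 2 - s ^ 2) * deriv f s))
      ((W ^ 2 * (T ^ 2 - t ^ 2) + lam) * f t) t := fun t => by
    have q : HasDerivAt (fun s : ℝ => T ^ 2 - s ^ 2) (-(2 * t)) t := by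
      simpa using (hasDerivAt_pow 2 t).const_sub (T ^ 2)
    refine (q.mul (hasDerivAt_of_contDiff hf' t)).neg.congr_deriv ?_
    have := hl t
    rw [_root_.prolateDiffOp] at this
    linarith
  rw [intervalIntegral.integral_eq_sub_of_hasDerivAt (fun t _ => hd t)
    (Continuous.intervalIntegrable (by fun_prop) _ _)]
  ring

/-- For `λ ≥ 0` an eigenfunction vanishes somewhere on `[-T, T]`. -/
theorem exists_zero_of_nonneg (hW : 0 < W) (hT : 0 < T) (hγ : γ ≠ 0) (h : IsBandTimeEigen W T γ f)
    {lam : ℝ} (hl : SolvesPSWEq W T lam f) (hlam : 0 ≤ lam) : ∃ z, |z| ≤ T ∧ f z = 0 := by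
  refine exists_zero_of_integral_mul_eq_zero hT (by fun_prop) h.cont (fun t ht => ?_) ?_
    (h.integral_weight_mul_eq_zero hγ hl)
  · have : t ^ 2 ≤ T ^ 2 := by rw [← sq_abs]; gcongr
    have : 0 ≤ W ^ 2 * (T ^ 2 - t ^ 2) := mul_nonneg (sq_nonneg _) (by linarith)
    linarith
  · have : 0 < W ^ 2 * T ^ 2 := by positivity
    linarith

/-- The equation multiplied by f integrates to zero; dropping the terms with f'² and t²f² leaves (-λ
- W²T²) times the inner energy, which is therefore at most 0. -/
theorem neg_lam_le (hW : 0 < W) (hT : 0 < T) (hγ : γ ≠ 0) (h : IsBandTimeEigen W T γ f)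
    (hne : f ≠ 0) {lam : ℝ} (hl : SolvesPSWEq W T lam f) : -lam ≤ W ^ 2 * T ^ 2 := by
  have hf := h.contDiff hγ
  have hf' := contDiff_deriv hf
  have c0 := hf.continuous
  have c1 := hf'.continuous
  have hd : ∀ t, HasDerivAt (fun s => (T ^ 2 - s ^ 2) * deriv f s * f s)
      ((T ^ 2 - t ^ 2) * deriv f t ^ 2 - W ^ 2 * (T ^ 2 - t ^ 2) * f t ^ 2 - lam * f t ^ 2) t :=
    fun t => by
    have q : HasDerivAt (fun s : ℝ => T ^ 2 - s ^ 2) (-(2 * t)) t := by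
      simpa using (hasDerivAt_pow 2 t).const_sub (T ^ 2)
    refine ((q.mul (hasDerivAt_of_contDiff hf' t)).mul
      (hasDerivAt_of_contDiff hf t)).congr_deriv ?_
    have := hl t
    rw [_root_.prolateDiffOp] at this
    simp only [Pi.mul_apply]
    linear_combination f t * this
  have e := intervalIntegral.integral_eq_sub_of_hasDerivAt (a := -T) (b := T) (fun t _ => hd t)
    (Continuous.intervalIntegrable (by fun_prop) _ _)
  have e' : ∫ t in (-T)..T, ((T ^ 2 - t ^ 2) * deriv f t ^ 2 - W ^ 2 * (T ^ 2 - t ^ 2) * f t ^ 2 -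
      lam * f t ^ 2) = 0 := by
    rw [e]; ring
  have hm : ∫ t in (-T)..T, (-lam - W ^ 2 * T ^ 2) * f t ^ 2 ≤
      ∫ t in (-T)..T, ((T ^ 2 - t ^ 2) * deriv f t ^ 2 - W ^ 2 * (T ^ 2 - t ^ 2) * f t ^ 2 -
      lam * f t ^ 2) := by
    refine intervalIntegral.integral_mono_on (by linarith)
      (Continuous.intervalIntegrable (by fun_prop) _ _)
      (Continuous.intervalIntegrable (by fun_prop) _ _) (fun t ht => ?_)
    have h1 : t ^ 2 ≤ T ^ 2 := sq_le_sq' ht.1 ht.2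
    have h2 : 0 ≤ (T ^ 2 - t ^ 2) * deriv f t ^ 2 := mul_nonneg (by linarith) (sq_nonneg _)
    have h3 : 0 ≤ W ^ 2 * t ^ 2 * f t ^ 2 := by positivity
    linarith
  rw [e', intervalIntegral.integral_const_mul] at hm
  have hpos : 0 < energyInside T f := by
    rw [h.energyInside_eq_mul hW hγ]
    exact mul_pos (h.gamma_pos hW hT hγ hne) (h.integral_sq_pos hW hγ hne)
  have : -lam - W ^ 2 * T ^ 2 ≤ 0 := by
    by_contra! hc
    exact absurd (mul_pos hc hpos) (not_lt.2 hm)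
  linarith

end IsBandTimeEigen

/-! ### Compact operators given by curves in a Hilbert space. -/

section PairingOperator

variable {X H : Type*} [TopologicalSpace X] [CompactSpace X] [NormedAddCommGroup H]
  [InnerProductSpace ℝ H]

/-- The operator `f ↦ (t ↦ ⟪a t, f⟫)` given by a continuous curve `a` in a Hilbert space. -/
noncomputable def pairingOp (a : C(X, H)) : H →L[ℝ] C(X, ℝ) :=
  LinearMap.mkContinuous
    { toFun := fun f => ⟨fun t => inner ℝ (a t) f, by fun_prop⟩
      map_add' := fun f g => by ext t; simp [inner_add_right]
      map_smul' := fun c f => by ext t; simp [inner_smul_right] } ‖a‖ (fun f => by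
    refine (ContinuousMap.norm_le _ (by positivity)).2 fun t => ?_
    exact (norm_inner_le_norm _ _).trans
      (mul_le_mul_of_nonneg_right (a.norm_coe_le_norm t) (norm_nonneg f)))

theorem pairingOp_apply (a : C(X, H)) (f : H) (t : X) : pairingOp a f t = inner ℝ (a t) f := rfl

theorem norm_pairingOp_sub_le (a b : C(X, H)) : ‖pairingOp a - pairingOp b‖ ≤ ‖a - b‖ := by
  refine ContinuousLinearMap.opNorm_le_bound _ (norm_nonneg _) fun f => ?_
  refine (ContinuousMap.norm_le _ (by positivity)).2 fun t => ?_
  have : (pairingOp a - pairingOp b) f t = inner ℝ ((a - b) t) f := by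
    simp [pairingOp_apply, inner_sub_left]
  rw [this]
  exact (norm_inner_le_norm _ _).trans
    (mul_le_mul_of_nonneg_right ((a - b).norm_coe_le_norm t) (norm_nonneg f))

/-- Gives norm continuity of B_W D_T in W. The target is C(X, ℝ) rather than L², so that limits of
eigenfunctions are uniform. -/
theorem continuous_pairingOp : Continuous (pairingOp : C(X, H) → H →L[ℝ] C(X, ℝ)) := by
  have h : LipschitzWith 1 (pairingOp : C(X, H) → H →L[ℝ] C(X, ℝ)) :=
    LipschitzWith.of_dist_le_mul fun a b => by
      simpa [dist_eq_norm] using norm_pairingOp_sub_le a b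
  exact h.continuous

/-- Arzelà–Ascoli: for ‖f‖ ≤ 1 the oscillation of ⟨a t, f⟩ is at most that of the curve itself,
whence equicontinuity. -/
theorem isCompactOperator_pairingOp (a : C(X, H)) : IsCompactOperator (pairingOp a) := by
  let e := ContinuousMap.linearIsometryBoundedOfCompact X ℝ ℝ
  have hc : IsCompactOperator fun f => e (pairingOp a f) := by
    rw [isCompactOperator_iff_exists_mem_nhds_isCompact_closure_image]
    refine ⟨Metric.closedBall 0 1, Metric.closedBall_mem_nhds 0 one_pos, ?_⟩
    refine BoundedContinuousFunction.arzela_ascoli (Metric.closedBall 0 ‖a‖)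
      (isCompact_closedBall _ _) _ ?_ ?_
    · rintro _ t ⟨f, hf, rfl⟩
      rw [mem_closedBall_zero_iff] at hf ⊢
      refine (norm_inner_le_norm (a t) f).trans ?_
      exact (mul_le_mul (a.norm_coe_le_norm t) hf (norm_nonneg _) (norm_nonneg _)).trans_eq
        (mul_one _)
    · intro x
      rw [Metric.equicontinuousAt_iff_pair]
      intro ε hε
      refine ⟨a ⁻¹' Metric.ball (a x) (ε / 2),
        a.continuous.continuousAt (Metric.ball_mem_nhds _ (half_pos hε)), ?_⟩
      rintro y hy z hz ⟨_, f, hf, rfl⟩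
      rw [mem_closedBall_zero_iff] at hf
      have h1 : dist (a y) (a z) < ε := by
        have := dist_triangle_right (a y) (a z) (a x)
        have hy' : dist (a y) (a x) < ε / 2 := hy
        have hz' : dist (a z) (a x) < ε / 2 := hz
        linarith
      have h2 : dist (inner ℝ (a y) f) (inner ℝ (a z) f) < ε := by
        rw [dist_eq_norm, ← inner_sub_left]
        refine (norm_inner_le_norm _ _).trans_lt (lt_of_le_of_lt ?_ h1)
        rw [dist_eq_norm]
        exact mul_le_of_le_one_right (norm_nonneg _) hf
      exact h2
  have := hc.continuous_comp e.symm.continuous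
  simpa [Function.comp_def] using this

end PairingOperator

/-! ### The operator on L²(-T, T) and its top eigenvectors. -/

/-- The Hilbert space `L²(-T, T)`. -/
abbrev TimeL2 (T : ℝ) : Type := Lp ℝ 2 (volume.restrict (Set.Ioc (-T) T))

/-- The extension of continuous functions on `[-T, T]` by constants. -/
noncomputable def contExtend {T : ℝ} (hT : 0 < T) :
    C(Set.Icc (-T) T, ℝ) →L[ℝ] BoundedContinuousFunction ℝ ℝ :=
  LinearMap.mkContinuous
    { toFun := fun u => (BoundedContinuousFunction.mkOfCompact u).compContinuous
        ⟨Set.projIcc (-T) T (by linarith), continuous_projIcc⟩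
      map_add' := fun u v => by ext t; simp
      map_smul' := fun c u => by ext t; simp } 1 (fun u => by
    rw [one_mul]
    exact (BoundedContinuousFunction.norm_compContinuous_le _ _).trans_eq
      (BoundedContinuousFunction.norm_mkOfCompact u))

/-- The embedding of the continuous functions on `[-T, T]` into `L²(-T, T)`. -/
noncomputable def contToTimeL2 {T : ℝ} (hT : 0 < T) : C(Set.Icc (-T) T, ℝ) →L[ℝ] TimeL2 T :=
  (BoundedContinuousFunction.toLp (E := ℝ) 2 (volume.restrict (Set.Ioc (-T) T)) ℝ).comp
    (contExtend hT)

theorem contToTimeL2_ae_eq {T : ℝ} (hT : 0 < T) (u : C(Set.Icc (-T) T, ℝ)) :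
    contToTimeL2 hT u =ᵐ[volume.restrict (Set.Ioc (-T) T)]
      fun t => u (Set.projIcc (-T) T (by linarith) t) :=
  BoundedContinuousFunction.coeFn_toLp 2 (volume.restrict (Set.Ioc (-T) T)) ℝ (contExtend hT u)

theorem contToTimeL2_restrict_ae_eq {T : ℝ} (hT : 0 < T) {u : C(Set.Icc (-T) T, ℝ)} {F : ℝ → ℝ}
    (h : ∀ t : Set.Icc (-T) T, u t = F t) :
    contToTimeL2 hT u =ᵐ[volume.restrict (Set.Ioc (-T) T)] F := by
  filter_upwards [contToTimeL2_ae_eq hT u, ae_restrict_mem measurableSet_Ioc] with t ht hm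
  rw [ht, h, Set.projIcc_of_mem _ (Set.Ioc_subset_Icc_self hm)]

theorem TimeL2.inner_eq {T : ℝ} (f g : TimeL2 T) :
    inner ℝ f g = ∫ s in Set.Ioc (-T) T, f s * g s := by
  rw [L2.inner_def]
  congr 1 with s
  simp [mul_comm]

theorem TimeL2.integrableOn {T : ℝ} (f : TimeL2 T) : IntegrableOn f (Set.Ioc (-T) T) :=
  (Lp.memLp f).integrable (by norm_num)

/-- The kernel of `B_W D_T` as a family of curves in `L²(-T, T)`. -/
noncomputable def samplingCurve {T : ℝ} (hT : 0 < T) : C(ℝ, C(Set.Icc (-T) T, TimeL2 T)) :=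
  -- Currying first in s and then in t turns joint continuity of the kernel into continuity in W for
  -- the uniform norm on curves.
  ContinuousMap.curry ⟨fun q => contToTimeL2 hT
      (ContinuousMap.curry (⟨fun q : (ℝ × Set.Icc (-T) T) × Set.Icc (-T) T =>
        samplingKernel q.1.1 (q.1.2 - q.2), by
          have := Real.continuous_sinc
          unfold samplingKernel
          fun_prop⟩ : C((ℝ × Set.Icc (-T) T) × Set.Icc (-T) T, ℝ)) q), by fun_prop⟩

theorem samplingCurve_ae_eq {T : ℝ} (hT : 0 < T) (W : ℝ) (t : Set.Icc (-T) T) :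
    samplingCurve hT W t =ᵐ[volume.restrict (Set.Ioc (-T) T)]
      fun s => samplingKernel W (t - s) :=
  contToTimeL2_restrict_ae_eq hT fun _ => rfl

theorem pairingOp_samplingCurve {T : ℝ} (hT : 0 < T) (W : ℝ) (f : TimeL2 T)
    (t : Set.Icc (-T) T) : pairingOp (samplingCurve hT W) f t = bandTimeLimit W T f t := by
  rw [pairingOp_apply, TimeL2.inner_eq, bandTimeLimit,
    intervalIntegral.integral_of_le (by linarith)]
  refine integral_congr_ae ?_
  filter_upwards [samplingCurve_ae_eq hT W t] with s hs
  rw [hs]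

/-- The operator `B_W D_T` on `L²(-T, T)`. -/
noncomputable def bandTimeOp {T : ℝ} (hT : 0 < T) (W : ℝ) : TimeL2 T →L[ℝ] TimeL2 T :=
  (contToTimeL2 hT).comp (pairingOp (samplingCurve hT W))

theorem continuous_bandTimeOp {T : ℝ} (hT : 0 < T) : Continuous (bandTimeOp hT) := by
  have := (continuous_pairingOp (X := Set.Icc (-T) T) (H := TimeL2 T)).comp
    (samplingCurve hT).continuous
  exact continuous_const.clm_comp this

theorem isCompactOperator_bandTimeOp {T : ℝ} (hT : 0 < T) (W : ℝ) :
    IsCompactOperator (bandTimeOp hT W) :=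
  (isCompactOperator_pairingOp _).clm_comp (contToTimeL2 hT)

theorem bandTimeOp_ae_eq {T : ℝ} (hT : 0 < T) (W : ℝ) (f : TimeL2 T) :
    bandTimeOp hT W f =ᵐ[volume.restrict (Set.Ioc (-T) T)] bandTimeLimit W T f :=
  contToTimeL2_restrict_ae_eq hT (pairingOp_samplingCurve hT W f)

theorem isSelfAdjoint_bandTimeOp {T : ℝ} (hT : 0 < T) {W : ℝ} (hW : 0 ≤ W) :
    IsSelfAdjoint (bandTimeOp hT W) := by
  rw [ContinuousLinearMap.isSelfAdjoint_iff_isSymmetric]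
  intro f g
  have hle : -T ≤ T := by linarith
  have key : ∀ f g : TimeL2 T, inner ℝ (bandTimeOp hT W f) g =
      ∫ t in Set.Ioc (-T) T, ∫ s in Set.Ioc (-T) T, samplingKernel W (t - s) * (g t * f s) := by
    intro f g
    rw [TimeL2.inner_eq]
    refine integral_congr_ae ?_
    filter_upwards [bandTimeOp_ae_eq hT W f] with t ht
    rw [ht, bandTimeLimit, intervalIntegral.integral_of_le hle, ← integral_mul_const]
    congr 1 with s
    ring
  simp only [ContinuousLinearMap.coe_coe]
  rw [← real_inner_comm f (bandTimeOp hT W g), key f g, key g f, integral_integral_swap]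
  · congr 1 with s
    congr 1 with t
    rw [← samplingKernel_neg]
    congr 1
    · congr 1
      ring
    · ring
  · refine (((TimeL2.integrableOn g).mul_prod (TimeL2.integrableOn f)).bdd_mul
      (f := fun z => samplingKernel W (z.1 - z.2)) (c := W / Real.pi) ?_ ?_)
    · exact ((continuous_samplingKernel W).comp
        (continuous_fst.sub continuous_snd)).aestronglyMeasurable
    · exact Filter.Eventually.of_forall fun z => abs_samplingKernel_le hW _

theorem bandTimeLimit_congr_ae {W T : ℝ} (hT : 0 < T) {f g : ℝ → ℝ}
    (h : f =ᵐ[volume.restrict (Set.Ioc (-T) T)] g) (t : ℝ) :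
    bandTimeLimit W T f t = bandTimeLimit W T g t := by
  rw [bandTimeLimit, bandTimeLimit, intervalIntegral.integral_of_le (by linarith),
    intervalIntegral.integral_of_le (by linarith)]
  refine integral_congr_ae ?_
  filter_upwards [h] with s hs
  rw [hs]

/-- The restriction of a continuous function to `[-T, T]`, as an element of `L²(-T, T)`. -/
noncomputable def restrictL2 {T : ℝ} (hT : 0 < T) (F : C(ℝ, ℝ)) : TimeL2 T :=
  contToTimeL2 hT (F.restrict (Set.Icc (-T) T))

theorem restrictL2_ae_eq {T : ℝ} (hT : 0 < T) (F : C(ℝ, ℝ)) :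
    restrictL2 hT F =ᵐ[volume.restrict (Set.Ioc (-T) T)] F :=
  contToTimeL2_restrict_ae_eq hT fun _ => rfl

theorem TimeL2.norm_sq {T : ℝ} (hT : 0 < T) {f : TimeL2 T} {F : ℝ → ℝ}
    (h : f =ᵐ[volume.restrict (Set.Ioc (-T) T)] F) : ‖f‖ ^ 2 = energyInside T F := by
  rw [← real_inner_self_eq_norm_sq, TimeL2.inner_eq, energyInside,
    intervalIntegral.integral_of_le (by linarith)]
  refine integral_congr_ae ?_
  filter_upwards [h] with s hs
  rw [hs, pow_two]

/-- Eigenvectors of the operator on `L²(-T, T)` extend to eigenfunctions on the real line. -/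
theorem isBandTimeEigen_of_bandTimeOp {T : ℝ} (hT : 0 < T) {W : ℝ} (hW : 0 ≤ W) {m : ℝ}
    (hm : m ≠ 0) {f : TimeL2 T} (h : bandTimeOp hT W f = m • f) :
    IsBandTimeEigen W T m (fun t => m⁻¹ * bandTimeLimit W T f t) ∧
      f =ᵐ[volume.restrict (Set.Ioc (-T) T)] fun t => m⁻¹ * bandTimeLimit W T f t := by
  have hae : f =ᵐ[volume.restrict (Set.Ioc (-T) T)] fun t => m⁻¹ * bandTimeLimit W T f t := by
    filter_upwards [bandTimeOp_ae_eq hT W f, h ▸ Lp.coeFn_smul m f] with t h1 h2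
    rw [← h1, h2]
    simp [inv_mul_cancel_left₀ hm]
  have hi : IntervalIntegrable f volume (-T) T := by
    rw [intervalIntegrable_iff_integrableOn_Ioc_of_le (by linarith)]
    exact TimeL2.integrableOn f
  refine ⟨⟨continuous_const.mul (continuous_bandTimeLimit hW hi), fun t => ?_⟩, hae⟩
  rw [← bandTimeLimit_congr_ae hT hae, mul_inv_cancel_left₀ hm]

theorem bandTimeOp_restrictL2 {T : ℝ} (hT : 0 < T) {W m : ℝ} {F : C(ℝ, ℝ)}
    (h : IsBandTimeEigen W T m F) : bandTimeOp hT W (restrictL2 hT F) = m • restrictL2 hT F := by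
  refine Lp.ext ?_
  filter_upwards [bandTimeOp_ae_eq hT W (restrictL2 hT F), restrictL2_ae_eq hT F,
    Lp.coeFn_smul m (restrictL2 hT F)] with t h1 h2 h3
  rw [h1, h3, bandTimeLimit_congr_ae hT (restrictL2_ae_eq hT F), h.eq, Pi.smul_apply, h2,
    smul_eq_mul]

/-- Tested on ρ_W itself: by evenness the image at 0 is the integral of ρ_W², which is positive. -/
theorem bandTimeOp_ne_zero {T : ℝ} (hT : 0 < T) {W : ℝ} (hW : 0 < W) : bandTimeOp hT W ≠ 0 := by
  intro h0
  let F : C(ℝ, ℝ) := ⟨samplingKernel W, continuous_samplingKernel W⟩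
  have h1 := bandTimeOp_ae_eq hT W (restrictL2 hT F)
  rw [h0, zero_apply] at h1
  have h2 : bandTimeLimit W T F =ᵐ[volume.restrict (Set.Ioc (-T) T)] 0 := by
    filter_upwards [h1, Lp.coeFn_zero ℝ 2 (volume.restrict (Set.Ioc (-T) T))] with t e1 e2
    rw [← bandTimeLimit_congr_ae hT (restrictL2_ae_eq hT F), ← e1, e2]
  have hc : Continuous (bandTimeLimit W T F) :=
    continuous_bandTimeLimit hW.le (F.continuous.intervalIntegrable _ _)
  have h3 := Measure.eqOn_Ioc_of_ae_eq volume h2 hc.continuousOn continuousOn_const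
    (show (0 : ℝ) ∈ Set.Ioc (-T) T from ⟨by linarith, hT.le⟩)
  have h4 : 0 < bandTimeLimit W T F 0 := by
    rw [bandTimeLimit]
    have c := continuous_samplingKernel W
    have e : ∀ s, samplingKernel W (0 - s) * F s = samplingKernel W s ^ 2 := fun s => by
      rw [zero_sub, samplingKernel_neg, pow_two]
      rfl
    simp only [e]
    refine intervalIntegral.integral_pos (by linarith) (by fun_prop) (fun _ _ => sq_nonneg _)
      ⟨0, ⟨by linarith, hT.le⟩, ?_⟩
    have := Real.pi_pos
    simp only [samplingKernel, mul_zero, Real.sinc_zero, mul_one]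
    positivity
  exact h4.ne' h3

theorem norm_bandTimeOp_pos {T : ℝ} (hT : 0 < T) {W : ℝ} (hW : 0 < W) : 0 < ‖bandTimeOp hT W‖ :=
  norm_pos_iff.2 (bandTimeOp_ne_zero hT hW)

theorem eigenfunction_ne_zero {T : ℝ} (hT : 0 < T) {f : TimeL2 T} (hf : f ≠ 0) {F : ℝ → ℝ}
    (h : f =ᵐ[volume.restrict (Set.Ioc (-T) T)] F) : F ≠ 0 := by
  rintro rfl
  have := TimeL2.norm_sq hT h
  simp [energyInside, hf] at this

theorem exists_top_eigenvector {T : ℝ} (hT : 0 < T) {W : ℝ} (hW : 0 < W) :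
    ∃ f : TimeL2 T, ‖f‖ = 1 ∧ bandTimeOp hT W f = ‖bandTimeOp hT W‖ • f := by
  have hrad := (bandTimeOp hT W).spectralRadius_eq_nnnorm (isSelfAdjoint_bandTimeOp hT hW.le)
  have hpos := norm_bandTimeOp_pos hT hW
  -- Over ℝ nonemptiness is not automatic; it follows because the spectral radius equals the nonzero
  -- norm. An extremal spectral value is an eigenvalue by compactness, and positivity of eigenvalues
  -- fixes its sign.
  have hne : (spectrum ℝ (bandTimeOp hT W)).Nonempty := by
    by_contra hempty
    rw [Set.not_nonempty_iff_eq_empty] at hempty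
    rw [spectralRadius, hempty] at hrad
    have h0 : ‖bandTimeOp hT W‖₊ = 0 := by simpa using hrad.symm
    exact bandTimeOp_ne_zero hT hW (nnnorm_eq_zero.1 h0)
  obtain ⟨k, hk, hkn⟩ := spectrum.exists_nnnorm_eq_spectralRadius_of_nonempty hne
  rw [hrad] at hkn
  have hkn' : ‖k‖ = ‖bandTimeOp hT W‖ := by
    have : ‖k‖₊ = ‖bandTimeOp hT W‖₊ := by exact_mod_cast hkn
    exact congrArg NNReal.toReal this
  have hk0 : k ≠ 0 := norm_pos_iff.1 (hkn' ▸ hpos)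
  obtain ⟨f, hf⟩ := (((isCompactOperator_bandTimeOp hT W).hasEigenvalue_iff_mem_spectrum hk0).2
    hk).exists_hasEigenvector
  have hfe : bandTimeOp hT W f = k • f := hf.apply_eq_smul
  have hf0 : f ≠ 0 := hf.2
  obtain ⟨hF, hae⟩ := isBandTimeEigen_of_bandTimeOp hT hW.le hk0 hfe
  have hkpos := hF.gamma_pos hW hT hk0 (eigenfunction_ne_zero hT hf0 hae)
  rw [Real.norm_of_nonneg hkpos.le] at hkn'
  refine ⟨‖f‖⁻¹ • f, norm_smul_inv_norm hf0, ?_⟩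
  rw [map_smul, hfe, hkn', smul_comm]

theorem restrictL2_ne_zero {T : ℝ} (hT : 0 < T) {W γ : ℝ} (hW : 0 < W) (hγ : γ ≠ 0) {F : C(ℝ, ℝ)}
    (h : IsBandTimeEigen W T γ F) (hF : (F : ℝ → ℝ) ≠ 0) : restrictL2 hT F ≠ 0 := by
  intro h0
  have h1 := TimeL2.norm_sq hT (restrictL2_ae_eq hT F)
  rw [h0, norm_zero, h.energyInside_eq_mul hW hγ] at h1
  have := mul_pos (h.gamma_pos hW hT hγ hF) (h.integral_sq_pos hW hγ hF)
  simp only [ne_eq, OfNat.ofNat_ne_zero, not_false_eq_true, zero_pow] at h1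
  linarith

theorem IsBandTimeEigen.le_norm {T : ℝ} (hT : 0 < T) {W γ : ℝ} (hW : 0 < W) (hγ : γ ≠ 0)
    {F : ℝ → ℝ} (h : IsBandTimeEigen W T γ F) (hF : F ≠ 0) : γ ≤ ‖bandTimeOp hT W‖ := by
  let G : C(ℝ, ℝ) := ⟨F, h.cont⟩
  have hG : IsBandTimeEigen W T γ G := h
  have h0 := restrictL2_ne_zero hT hW hγ hG hF
  have h1 := (bandTimeOp hT W).le_opNorm (restrictL2 hT G)
  rw [bandTimeOp_restrictL2 hT hG, norm_smul] at h1
  exact (le_abs_self γ).trans (le_of_mul_le_mul_right h1 (norm_pos_iff.2 h0))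

/-- Limits of top eigenvectors along a convergent sequence of band widths. -/
theorem exists_limit_top_eigenvector {T : ℝ} (hT : 0 < T) {W : ℝ} (hW : 0 < W) {w : ℕ → ℝ}
    (hw : Filter.Tendsto w Filter.atTop (nhds W)) {f : ℕ → TimeL2 T} (hf1 : ∀ j, ‖f j‖ = 1)
    (hf : ∀ j, bandTimeOp hT (w j) (f j) = ‖bandTimeOp hT (w j)‖ • f j) :
    ∃ (g : TimeL2 T) (φ : ℕ → ℕ), StrictMono φ ∧ ‖g‖ = 1 ∧
      bandTimeOp hT W g = ‖bandTimeOp hT W‖ • g ∧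
      Filter.Tendsto (fun j => pairingOp (samplingCurve hT (w (φ j))) (f (φ j))) Filter.atTop
        (nhds (pairingOp (samplingCurve hT W) g)) := by
  set M := ‖bandTimeOp hT W‖ with hM
  have hMpos : 0 < M := norm_bandTimeOp_pos hT hW
  obtain ⟨h, -, φ, hφ, hlim⟩ := ((isCompactOperator_bandTimeOp hT W).isCompact_closure_image_closedBall
    (f := (bandTimeOp hT W : TimeL2 T →ₗ[ℝ] TimeL2 T)) 1).tendsto_subseq
    (x := fun j => bandTimeOp hT W (f j))
    (fun j => subset_closure ⟨f j, by simp [hf1 j], rfl⟩)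
  have hop : Filter.Tendsto (fun j => bandTimeOp hT (w (φ j))) Filter.atTop
      (nhds (bandTimeOp hT W)) :=
    ((continuous_bandTimeOp hT).tendsto W).comp (hw.comp hφ.tendsto_atTop)
  have hdiff : Filter.Tendsto (fun j => bandTimeOp hT (w (φ j)) (f (φ j)) -
      bandTimeOp hT W (f (φ j))) Filter.atTop (nhds 0) := by
    refine squeeze_zero_norm (fun j => ?_) (tendsto_iff_norm_sub_tendsto_zero.1 hop)
    have := (bandTimeOp hT (w (φ j)) - bandTimeOp hT W).le_opNorm (f (φ j))
    rwa [hf1, mul_one] at this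
  have h1 : Filter.Tendsto (fun j => bandTimeOp hT (w (φ j)) (f (φ j))) Filter.atTop (nhds h) := by
    simpa using hdiff.add hlim
  -- The eigenvalues converge to M > 0, so convergence of the images upgrades to norm convergence of
  -- the eigenvectors.
  have hfl : Filter.Tendsto (fun j => f (φ j)) Filter.atTop (nhds (M⁻¹ • h)) := by
    have h2 : Filter.Tendsto (fun j => ‖bandTimeOp hT (w (φ j))‖⁻¹) Filter.atTop (nhds M⁻¹) :=
      hop.norm.inv₀ hMpos.ne'
    have hev : ∀ᶠ j in Filter.atTop, ‖bandTimeOp hT (w (φ j))‖ ≠ 0 :=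
      hop.norm.eventually_ne hMpos.ne'
    refine (h2.smul h1).congr' ?_
    filter_upwards [hev] with j hj
    rw [hf, inv_smul_smul₀ hj]
  refine ⟨M⁻¹ • h, φ, hφ, ?_, ?_, ?_⟩
  · exact tendsto_nhds_unique hfl.norm (by simp [hf1])
  · have h3 := ((bandTimeOp hT W).continuous.tendsto _).comp hfl
    rw [smul_inv_smul₀ hMpos.ne']
    exact tendsto_nhds_unique h3 hlim
  · have h4 : Filter.Tendsto (fun j => pairingOp (samplingCurve hT (w (φ j)))) Filter.atTop
        (nhds (pairingOp (samplingCurve hT W))) :=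
      ((continuous_pairingOp.comp (samplingCurve hT).continuous).tendsto W).comp
        (hw.comp hφ.tendsto_atTop)
    exact (isBoundedBilinearMap_apply.continuous.tendsto
      (pairingOp (samplingCurve hT W), M⁻¹ • h)).comp (h4.prodMk_nhds hfl)

/-! ### Positivity of the top eigenfunction by deformation of W. -/

theorem samplingKernel_nonneg {W x : ℝ} (hW : 0 ≤ W) (hx : W * |x| ≤ Real.pi) :
    0 ≤ samplingKernel W x := by
  rw [← samplingKernel_neg] at *
  have e : samplingKernel W (-x) = samplingKernel W |x| := by
    rcases abs_choice x with h | h <;> rw [h]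
    exact samplingKernel_neg W x
  rw [e, samplingKernel]
  refine mul_nonneg (div_nonneg hW Real.pi_pos.le) ?_
  rcases eq_or_ne (W * |x|) 0 with h | h
  · simp [h]
  · rw [Real.sinc_of_ne_zero h]
    have h0 : 0 ≤ W * |x| := mul_nonneg hW (abs_nonneg x)
    exact div_nonneg (Real.sin_nonneg_of_nonneg_of_le_pi h0 hx) h0

/-- Band widths for which there is a top eigenfunction that is positive on `[-T, T]`. -/
def positiveTopSet {T : ℝ} (hT : 0 < T) : Set ℝ :=
  {W | 0 < W ∧ ∃ F : ℝ → ℝ, IsBandTimeEigen W T ‖bandTimeOp hT W‖ F ∧ ∀ t, |t| ≤ T → 0 < F t}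

/-- For small band widths the kernel is nonnegative on the square, so that the modulus of a top
eigenfunction is a top eigenfunction. -/
theorem mem_positiveTopSet_of_le {T : ℝ} (hT : 0 < T) {W : ℝ} (hW : 0 < W)
    (hWT : W * (2 * T) ≤ Real.pi) : W ∈ positiveTopSet hT := by
  obtain ⟨f, hf1, hf⟩ := exists_top_eigenvector hT hW
  have hMpos := norm_bandTimeOp_pos hT hW
  set M := ‖bandTimeOp hT W‖ with hM
  have hf0 : f ≠ 0 := by
    rintro rfl
    simp at hf1
  obtain ⟨hF, hae⟩ := isBandTimeEigen_of_bandTimeOp hT hW.le hMpos.ne' hf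
  set F := fun t => M⁻¹ * bandTimeLimit W T f t
  have hFne := eigenfunction_ne_zero hT hf0 hae
  have c := continuous_samplingKernel W
  have cF := hF.cont
  let G : C(ℝ, ℝ) := ⟨fun t => |F t|, cF.abs⟩
  have cG : Continuous (bandTimeLimit W T G) :=
    continuous_bandTimeLimit hW.le (G.continuous.intervalIntegrable _ _)
  -- With G = |F|, a nonnegative kernel gives MG ≤ B_W D_T G pointwise. The operator norm M gives
  -- the reverse inequality for L² norms, so continuity forces equality on [-T, T].
  have hge : ∀ t, |t| ≤ T → M * G t ≤ bandTimeLimit W T G t := by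
    intro t ht
    have h1 : M * G t = |bandTimeLimit W T F t| := by
      rw [hF.eq, abs_mul, abs_of_pos hMpos]
      rfl
    rw [h1, bandTimeLimit, bandTimeLimit]
    refine (intervalIntegral.abs_integral_le_integral_abs (by linarith)).trans
      (intervalIntegral.integral_mono_on (by linarith)
        (Continuous.intervalIntegrable (by fun_prop) _ _)
        (Continuous.intervalIntegrable (by fun_prop) _ _) fun s hs => ?_)
    have hk : 0 ≤ samplingKernel W (t - s) := by
      refine samplingKernel_nonneg hW.le (le_trans ?_ hWT)
      refine mul_le_mul_of_nonneg_left ?_ hW.le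
      have h2 := abs_le.1 ht
      exact abs_le.2 ⟨by linarith [hs.1, hs.2], by linarith [hs.1, hs.2]⟩
    rw [abs_mul, abs_of_nonneg hk]
    rfl
  have hG0 : ∀ t, 0 ≤ G t := fun t => abs_nonneg _
  have hnorm : ∫ t in (-T)..T, (bandTimeLimit W T G t ^ 2 - (M * G t) ^ 2) ≤ 0 := by
    have h1 := (bandTimeOp hT W).le_opNorm (restrictL2 hT G)
    have h2 : bandTimeOp hT W (restrictL2 hT G) =ᵐ[volume.restrict (Set.Ioc (-T) T)]
        bandTimeLimit W T G := by
      filter_upwards [bandTimeOp_ae_eq hT W (restrictL2 hT G)] with t ht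
      rw [ht, bandTimeLimit_congr_ae hT (restrictL2_ae_eq hT G)]
    have h3 := pow_le_pow_left₀ (norm_nonneg _) h1 2
    rw [mul_pow, TimeL2.norm_sq hT h2, TimeL2.norm_sq hT (restrictL2_ae_eq hT G)] at h3
    rw [intervalIntegral.integral_sub (Continuous.intervalIntegrable (by fun_prop) _ _)
      (Continuous.intervalIntegrable (by fun_prop) _ _)]
    simp only [mul_pow]
    rw [intervalIntegral.integral_const_mul]
    simp only [energyInside] at h3
    linarith
  have hsq : ∀ t, |t| ≤ T → bandTimeLimit W T G t ^ 2 - (M * G t) ^ 2 = 0 := by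
    have hnn : ∀ t, |t| ≤ T → 0 ≤ bandTimeLimit W T G t ^ 2 - (M * G t) ^ 2 := fun t ht =>
      sub_nonneg.2 (pow_le_pow_left₀ (mul_nonneg hMpos.le (hG0 t)) (hge t ht) 2)
    intro t ht
    by_contra hne
    have := intervalIntegral.integral_pos (a := -T) (b := T)
      (f := fun t => bandTimeLimit W T G t ^ 2 - (M * G t) ^ 2) (by linarith) (by fun_prop)
      (fun x hx => hnn x (abs_le.2 ⟨hx.1.le, hx.2⟩))
      ⟨t, abs_le.1 ht, lt_of_le_of_ne (hnn t ht) (Ne.symm hne)⟩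
    linarith
  have heq : ∀ t, |t| ≤ T → bandTimeLimit W T G t = M * G t := by
    intro t ht
    have h1 : 0 ≤ M * G t := mul_nonneg hMpos.le (hG0 t)
    exact (pow_left_inj₀ (h1.trans (hge t ht)) h1 two_ne_zero).1 (sub_eq_zero.1 (hsq t ht))
  have hGe : ∀ t, |t| ≤ T → M⁻¹ * bandTimeLimit W T G t = G t := fun t ht => by
    rw [heq t ht, inv_mul_cancel_left₀ hMpos.ne']
  have hE : IsBandTimeEigen W T M (fun t => M⁻¹ * bandTimeLimit W T G t) := by
    refine ⟨continuous_const.mul cG, fun t => ?_⟩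
    rw [mul_inv_cancel_left₀ hMpos.ne']
    refine bandTimeLimit_congr_ae hT ?_ t
    filter_upwards [ae_restrict_mem measurableSet_Ioc] with s hs
    exact hGe s (abs_le.2 ⟨hs.1.le, hs.2⟩)
  have hEne : (fun t => M⁻¹ * bandTimeLimit W T G t) ≠ 0 := by
    intro h0
    have h1 := congrFun h0 T
    rw [hGe T (abs_of_pos hT).le] at h1
    exact hF.apply_ne_zero hT hMpos.ne' hFne (abs_eq_zero.1 h1)
  exact ⟨hW, _, hE, fun t ht => hE.pos_of_nonneg hT hMpos.ne' hEne
    (fun s hs => by rw [hGe s hs]; exact hG0 s) ht⟩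

/-- Let bad band widths tend to a good W. Normalized top eigenvectors subconverge, and by simplicity
the limit is a multiple of the positive F. Their images converge uniformly on [-T, T], so some
approximating eigenfunction has a constant sign there, a contradiction. -/
theorem isOpen_positiveTopSet {T : ℝ} (hT : 0 < T) : IsOpen (positiveTopSet hT) := by
  rw [← isClosed_compl_iff]
  refine IsSeqClosed.isClosed fun w W hw hlim => ?_
  rintro ⟨hW, F, hF, hFpos⟩
  obtain ⟨N, hN⟩ := Filter.eventually_atTop.1 (hlim.eventually (lt_mem_nhds hW))
  have hwpos : ∀ j, 0 < w (j + N) := fun j => hN _ (Nat.le_add_left _ _)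
  choose f hf1 hf using fun j => exists_top_eigenvector hT (hwpos j)
  obtain ⟨g, φ, hφ, hg1, hg, htend⟩ := exists_limit_top_eigenvector hT hW
    (hlim.comp (Filter.tendsto_add_atTop_nat N)) hf1 hf
  have hMpos := norm_bandTimeOp_pos hT hW
  have hg0 : g ≠ 0 := by
    rintro rfl
    simp at hg1
  obtain ⟨hG, hae⟩ := isBandTimeEigen_of_bandTimeOp hT hW.le hMpos.ne' hg
  have hFne : F ≠ 0 := fun h0 => by
    have := hFpos 0 (by simpa using hT.le)
    simp [h0] at this
  obtain ⟨c, hc⟩ := hF.exists_eq_mul hT hMpos.ne' hG hFne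
  have hc0 : c ≠ 0 := by
    rintro rfl
    exact eigenfunction_ne_zero hT hg0 hae (funext fun t => by simp [hc t])
  have hopen : ∀ᶠ u in nhds (pairingOp (samplingCurve hT W) g),
      Set.MapsTo (u : C(Set.Icc (-T) T, ℝ)) Set.univ {x | 0 < c * x} := by
    refine (ContinuousMap.isOpen_setOfPred_mapsTo isCompact_univ
      (isOpen_lt continuous_const (continuous_const.mul continuous_id))).mem_nhds ?_
    intro t _
    have h1 := hc t
    have h2 : bandTimeLimit W T g t = ‖bandTimeOp hT W‖ * (c * F t) := by
      rw [← h1, mul_inv_cancel_left₀ hMpos.ne']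
    rw [pairingOp_samplingCurve, h2]
    have h3 := hFpos t (abs_le.2 t.2)
    show 0 < c * (‖bandTimeOp hT W‖ * (c * F t))
    have h4 : 0 < c ^ 2 := by positivity
    nlinarith [mul_pos (mul_pos h4 hMpos) h3]
  obtain ⟨j, hj⟩ := (htend.eventually hopen).exists
  have hmj := norm_bandTimeOp_pos hT (hwpos (φ j))
  obtain ⟨hFj, -⟩ := isBandTimeEigen_of_bandTimeOp hT (hwpos (φ j)).le hmj.ne' (hf (φ j))
  refine hw (φ j + N) ⟨hwpos (φ j), _, hFj.smul c, fun t ht => ?_⟩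
  have h5 := hj (Set.mem_univ ⟨t, abs_le.1 ht⟩)
  simp only [Function.comp_apply, pairingOp_samplingCurve] at h5
  have h6 := mul_pos (inv_pos.2 hmj) h5
  show 0 < c * (‖bandTimeOp hT (w (φ j + N))‖⁻¹ * bandTimeLimit (w (φ j + N)) T (f (φ j)) t)
  rw [mul_left_comm]
  exact h6

/-- A limit of positive eigenfunctions is nonnegative on [-T, T], hence positive by `pos_of_nonneg`.
-/
theorem closure_positiveTopSet_inter {T : ℝ} (hT : 0 < T) :
    closure (positiveTopSet hT) ∩ Set.Ioi 0 ⊆ positiveTopSet hT := by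
  rintro W ⟨hcl, hW⟩
  replace hW : 0 < W := hW
  obtain ⟨w, hw, hlim⟩ := mem_closure_iff_seq_limit.1 hcl
  choose hwpos F hF hFpos using hw
  let G : ℕ → C(ℝ, ℝ) := fun j => ⟨F j, (hF j).cont⟩
  have hmj := fun j => norm_bandTimeOp_pos hT (hwpos j)
  have hG : ∀ j, IsBandTimeEigen (w j) T ‖bandTimeOp hT (w j)‖ (G j) := hF
  have hne : ∀ j, restrictL2 hT (G j) ≠ 0 := fun j =>
    restrictL2_ne_zero hT (hwpos j) (hmj j).ne' (hG j) fun h0 => by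
      have h1 := hFpos j 0 (by simpa using hT.le)
      have h2 := congrFun h0 0
      exact h1.ne' h2
  obtain ⟨g, φ, hφ, hg1, hg, htend⟩ := exists_limit_top_eigenvector hT hW hlim
    (f := fun j => ‖restrictL2 hT (G j)‖⁻¹ • restrictL2 hT (G j))
    (fun j => norm_smul_inv_norm (hne j))
    (fun j => by rw [map_smul, bandTimeOp_restrictL2 hT (hG j), smul_comm])
  have hMpos := norm_bandTimeOp_pos hT hW
  have hg0 : g ≠ 0 := by
    rintro rfl
    simp at hg1
  obtain ⟨hE, hae⟩ := isBandTimeEigen_of_bandTimeOp hT hW.le hMpos.ne' hg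
  refine ⟨hW, _, hE, fun t ht => hE.pos_of_nonneg hT hMpos.ne'
    (eigenfunction_ne_zero hT hg0 hae) (fun s hs => ?_) ht⟩
  refine mul_nonneg (inv_nonneg.2 hMpos.le) ?_
  let x : Set.Icc (-T) T := ⟨s, abs_le.1 hs⟩
  have h1 : Filter.Tendsto (fun j => pairingOp (samplingCurve hT (w (φ j)))
      (‖restrictL2 hT (G (φ j))‖⁻¹ • restrictL2 hT (G (φ j))) x) Filter.atTop
      (nhds (pairingOp (samplingCurve hT W) g x)) :=
    ((continuous_eval_const x).tendsto _).comp htend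
  rw [pairingOp_samplingCurve] at h1
  refine ge_of_tendsto' h1 fun j => ?_
  rw [map_smul, ContinuousMap.smul_apply, pairingOp_samplingCurve,
    bandTimeLimit_congr_ae hT (restrictL2_ae_eq hT _), (hG (φ j)).eq]
  exact mul_nonneg (inv_nonneg.2 (norm_nonneg _))
    (mul_nonneg (hmj _).le (hFpos (φ j) s hs).le)

/-- The eigenfunction of the largest eigenvalue of `B_W D_T` can be chosen positive on
`[-T, T]`. -/
theorem exists_positive_top_eigenfunction {W T : ℝ} (hW : 0 < W) (hT : 0 < T) :
    ∃ (γ₀ : ℝ) (p : ℝ → ℝ), γ₀ ≠ 0 ∧ IsBandTimeEigen W T γ₀ p ∧ (∀ t, |t| ≤ T → 0 < p t) ∧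
      ∀ (γ : ℝ) (f : ℝ → ℝ), γ ≠ 0 → IsBandTimeEigen W T γ f → f ≠ 0 → γ ≤ γ₀ := by
  -- Connectedness of (0, ∞), started at W = π/(2T), the largest width with W|t - s| ≤ π on the
  -- whole square.
  have hsub : Set.Ioi 0 ⊆ positiveTopSet hT :=
    isPreconnected_Ioi.subset_of_closure_inter_subset (isOpen_positiveTopSet hT)
      ⟨Real.pi / (2 * T), div_pos Real.pi_pos (by linarith),
        mem_positiveTopSet_of_le hT (div_pos Real.pi_pos (by linarith)) (by field_simp; rfl)⟩
      (closure_positiveTopSet_inter hT)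
  obtain ⟨-, F, hF, hpos⟩ := hsub hW
  exact ⟨_, F, (norm_bandTimeOp_pos hT hW).ne', hF, hpos,
    fun γ f hγ hf hne => hf.le_norm hT hW hγ hne⟩

/-! ### Orthogonality and zeros of the prolates. -/

theorem IsBandTimeEigen.integral_mul_eq_zero {W T γ γ' : ℝ} {f g : ℝ → ℝ} (hγ : γ ≠ 0)
    (hγ' : γ' ≠ 0) (h : IsBandTimeEigen W T γ f) (h' : IsBandTimeEigen W T γ' g) (hne : γ ≠ γ') :
    ∫ t in (-T)..T, g t * f t = 0 := by
  have e1 := h.integral_mul_self hγ h'.cont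
  have e2 := h'.integral_mul_self hγ' h.cont
  have e3 : ∫ t in (-T)..T, f t * g t = ∫ t in (-T)..T, g t * f t := by simp only [mul_comm]
  rw [e3] at e2
  set X := ∫ t in (-T)..T, g t * f t
  set Y := ∫ w in (-W)..W, timeSpectrum T f w * (starRingEnd ℂ) (timeSpectrum T g w) with hY
  have e4 : ∫ w in (-W)..W, timeSpectrum T g w * (starRingEnd ℂ) (timeSpectrum T f w) =
      (starRingEnd ℂ) Y := by
    rw [hY, ← intervalIntegral.intervalIntegral_conj]
    congr 1 with w
    rw [map_mul, Complex.conj_conj, mul_comm]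
  rw [e4] at e2
  have hpi : (Real.pi : ℂ) ≠ 0 := by exact_mod_cast Real.pi_ne_zero
  have hγc : (γ : ℂ) ≠ 0 := by exact_mod_cast hγ
  have hγc' : (γ' : ℂ) ≠ 0 := by exact_mod_cast hγ'
  have e5 : Y = ((2 * Real.pi * γ * X : ℝ) : ℂ) := by
    push_cast
    rw [e1]
    field_simp
  rw [e5, Complex.conj_ofReal] at e2
  have e6 : X = (2 * Real.pi * γ')⁻¹ * (2 * Real.pi * γ * X) := by exact_mod_cast e2
  have hpi' := Real.pi_ne_zero
  field_simp at e6
  have e7 : (γ' - γ) * X = 0 := by linarith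
  exact (mul_eq_zero.1 e7).resolve_left (sub_ne_zero.2 hne.symm)

/-- Every prolate except the one of the largest eigenvalue has a zero in `[-T, T]`. -/
theorem IsProlate.exists_zero {W T γ : ℝ} {n : ℕ} {ξ : ℝ → ℝ} (hW : 0 < W) (hT : 0 < T)
    (h : IsProlate W T n γ ξ) (hn : n ≠ 0) : ∃ z, |z| ≤ T ∧ ξ z = 0 := by
  have hE := h.1.isBandTimeEigen hW
  have hpos : {γ' : ℝ | γ < γ' ∧ ∃ f : ℝ → ℝ, IsProlateEigenfunction W T γ' f}.Nonempty := by
    rw [← Set.encard_ne_zero, h.2.2]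
    exact_mod_cast hn
  obtain ⟨γ', hlt, f, hf⟩ := hpos
  obtain ⟨γ₀, p, hγ₀, hp, hppos, hmax⟩ := exists_positive_top_eigenfunction hW hT
  have hle := hmax γ' f hf.1 (hf.isBandTimeEigen hW) hf.2.2.1
  exact exists_zero_of_integral_mul_eq_zero hT hp.cont hE.cont (fun t ht => (hppos t ht).le)
    (hppos 0 (by simpa using hT.le))
    (hE.integral_mul_eq_zero h.1.1 hγ₀ hp (hlt.trans_le hle).ne)

/-! ### The constants of the theorem. -/

theorem lineNorm_sq (f : ℝ → ℝ) : lineNorm f ^ 2 = ∫ t, f t ^ 2 :=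
  Real.sq_sqrt (integral_nonneg fun _ => sq_nonneg _)

theorem lineNorm_nonneg (f : ℝ → ℝ) : 0 ≤ lineNorm f := Real.sqrt_nonneg _

/-- If `C² ≤ a² + 2 b C` with `a, b, C` real, then `C ≤ √(a² + b²) + b`. -/
theorem le_sqrt_add_of_sq_le {a b C : ℝ} (h : C ^ 2 ≤ a ^ 2 + 2 * b * C) :
    C ≤ √(a ^ 2 + b ^ 2) + b := by
  have : C - b ≤ √(a ^ 2 + b ^ 2) := Real.le_sqrt_of_sq_le (by linarith)
  linarith

namespace IsProlate

variable {W T γ lam : ℝ} {n : ℕ} {ξ : ℝ → ℝ}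

theorem gamma_pos (hW : 0 < W) (hT : 0 < T) (h : IsProlate W T n γ ξ) : 0 < γ :=
  (h.1.isBandTimeEigen hW).gamma_pos hW hT h.1.1 h.1.2.2.1

theorem gamma_lt_one (hW : 0 < W) (hT : 0 < T) (h : IsProlate W T n γ ξ) : γ < 1 :=
  (h.1.isBandTimeEigen hW).gamma_lt_one hW hT h.1.1 h.1.2.2.1

theorem existsUnique_solvesPSWEq (hW : 0 < W) (hT : 0 < T) (h : IsProlate W T n γ ξ) :
    ∃! lam : ℝ, SolvesPSWEq W T lam ξ := by
  have hE := h.1.isBandTimeEigen hW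
  obtain ⟨lam, hl⟩ := hE.exists_solvesPSWEq hT h.1.1 h.1.2.2.1
  refine ⟨lam, hl, fun lam' hl' => ?_⟩
  have h1 := (hl' T).symm.trans (hl T)
  have h2 := mul_right_cancel₀ (hE.apply_ne_zero hT h.1.1 h.1.2.2.1) h1
  linarith

theorem lineNorm_deriv_lt (hW : 0 < W) (h : IsProlate W T n γ ξ) : lineNorm (deriv ξ) < W := by
  rw [lineNorm, Real.sqrt_lt' hW]
  have := (h.1.isBandTimeEigen hW).integral_deriv_sq_lt hW h.1.1 h.1.2.2.1
  rwa [h.2.1, mul_one] at this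

theorem energyInside_eq (hW : 0 < W) (h : IsProlate W T n γ ξ) : energyInside T ξ = γ := by
  rw [(h.1.isBandTimeEigen hW).energyInside_eq_mul hW h.1.1, h.2.1, mul_one]

theorem energyOutside_eq (hW : 0 < W) (hT : 0 < T) (h : IsProlate W T n γ ξ) :
    energyOutside T ξ = 1 - γ := by
  have := energyInside_add_energyOutside hT h.1.2.1
  rw [h.energyInside_eq hW, h.2.1] at this
  linarith

theorem energyInside_deriv_eq_mul (hW : 0 < W) (hT : 0 < T) (h : IsProlate W T n γ ξ)
    (hl : SolvesPSWEq W T lam ξ) :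
    energyInside T (deriv ξ) = γ * (lineNorm (deriv ξ) ^ 2 + lam / T * (ξ T ^ 2 / γ)) := by
  have hγ := (h.gamma_pos hW hT).ne'
  rw [(h.1.isBandTimeEigen hW).energyInside_deriv_eq hW hT h.1.1 hl, lineNorm_sq]
  field_simp

theorem energyOutside_deriv_eq_mul (hW : 0 < W) (hT : 0 < T) (h : IsProlate W T n γ ξ)
    (hl : SolvesPSWEq W T lam ξ) : energyOutside T (deriv ξ) =
      (1 - γ) * (lineNorm (deriv ξ) ^ 2 - lam / T * (ξ T ^ 2 / (1 - γ))) := by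
  have hE := h.1.isBandTimeEigen hW
  have h1 : 1 - γ ≠ 0 := (sub_pos.2 (h.gamma_lt_one hW hT)).ne'
  have h2 := energyInside_add_energyOutside hT (hE.memLp_deriv hW h.1.1)
  rw [hE.energyInside_deriv_eq hW hT h.1.1 hl, ← lineNorm_sq] at h2
  have h3 : (1 - γ) * (lam / T * (ξ T ^ 2 / (1 - γ))) = lam / T * ξ T ^ 2 := by field_simp
  rw [mul_sub, h3]
  linarith

theorem CIntra_sq (hW : 0 < W) (hT : 0 < T) (h : IsProlate W T n γ ξ)
    (hl : SolvesPSWEq W T lam ξ) :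
    CIntra T γ lam ξ ^ 2 = lineNorm (deriv ξ) ^ 2 + lam / T * (ξ T ^ 2 / γ) := by
  refine Real.sq_sqrt (nonneg_of_mul_nonneg_right ?_ (h.gamma_pos hW hT))
  rw [← h.energyInside_deriv_eq_mul hW hT hl]
  exact energyInside_nonneg hT _

theorem CExtra_sq (hW : 0 < W) (hT : 0 < T) (h : IsProlate W T n γ ξ)
    (hl : SolvesPSWEq W T lam ξ) :
    CExtra T γ lam ξ ^ 2 = lineNorm (deriv ξ) ^ 2 - lam / T * (ξ T ^ 2 / (1 - γ)) := by
  refine Real.sq_sqrt (nonneg_of_mul_nonneg_right ?_ (sub_pos.2 (h.gamma_lt_one hW hT)))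
  rw [← h.energyOutside_deriv_eq_mul hW hT hl]
  exact energyOutside_nonneg _ _

theorem sq_le_CExtra (hW : 0 < W) (hT : 0 < T) (h : IsProlate W T n γ ξ)
    (hl : SolvesPSWEq W T lam ξ) {t : ℝ} (ht : T ≤ |t|) :
    ξ t ^ 2 ≤ (1 - γ) * CExtra T γ lam ξ := by
  have hE := h.1.isBandTimeEigen hW
  obtain ⟨ε, hε, hp⟩ := hE.exists_hasParity hT h.1.1
  have h1 := hp.sq_le_outside hT hε (hE.contDiff h.1.1) h.1.2.1 (hE.memLp_deriv hW h.1.1) ht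
  have h0 : 0 ≤ 1 - γ := (sub_pos.2 (h.gamma_lt_one hW hT)).le
  rwa [h.energyOutside_eq hW hT, h.energyOutside_deriv_eq_mul hW hT hl, Real.sqrt_mul h0,
    ← mul_assoc, Real.mul_self_sqrt h0] at h1

theorem sq_sub_sq_le_CIntra (hW : 0 < W) (hT : 0 < T) (h : IsProlate W T n γ ξ)
    (hl : SolvesPSWEq W T lam ξ) {z t : ℝ} (hz : |z| ≤ T) (ht : |t| ≤ T) :
    ξ t ^ 2 - ξ z ^ 2 ≤ γ * CIntra T γ lam ξ := by
  have hE := h.1.isBandTimeEigen hW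
  obtain ⟨ε, hε, hp⟩ := hE.exists_hasParity hT h.1.1
  have h1 := hp.sq_sub_sq_le_inside hε (hE.contDiff h.1.1) hz ht
  have h0 := (h.gamma_pos hW hT).le
  rwa [h.energyInside_eq hW, h.energyInside_deriv_eq_mul hW hT hl, Real.sqrt_mul h0,
    ← mul_assoc, Real.mul_self_sqrt h0] at h1

/-- The comparison point is a zero of ξ when n ≠ 0; for n = 0 it is T, which costs the extra term
ξ(T)²/γ. -/
theorem sq_le_CIntraTilde (hW : 0 < W) (hT : 0 < T) (h : IsProlate W T n γ ξ)
    (hl : SolvesPSWEq W T lam ξ) {t : ℝ} (ht : |t| ≤ T) :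
    ξ t ^ 2 ≤ γ * CIntraTilde T n γ lam ξ := by
  have hγ := (h.gamma_pos hW hT).ne'
  rw [CIntraTilde, mul_add]
  by_cases hn : n = 0
  · have := h.sq_sub_sq_le_CIntra hW hT hl (z := T) (abs_of_pos hT).le ht
    rw [if_pos hn, mul_div_cancel₀ _ hγ]
    linarith
  · obtain ⟨z, hz, hz0⟩ := h.exists_zero hW hT hn
    have := h.sq_sub_sq_le_CIntra hW hT hl hz ht
    rw [hz0] at this
    rw [if_neg hn]
    linarith

/-- The supremum bound at T says ξ(T)²/(1 - γ) ≤ C. Inserted into C² it gives C² ≤ ‖ξ'‖² + 2bC with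
b = -λ/(2T) > 0. -/
theorem CExtra_le_CBase (hW : 0 < W) (hT : 0 < T) (h : IsProlate W T n γ ξ)
    (hl : SolvesPSWEq W T lam ξ) (hlam : lam < 0) :
    CExtra T γ lam ξ ≤ CBase T lam ξ - lam / (2 * T) := by
  have h1 := h.sq_le_CExtra hW hT hl (t := T) (abs_of_pos hT).ge
  have h0 : 0 < 1 - γ := sub_pos.2 (h.gamma_lt_one hW hT)
  have h2 : ξ T ^ 2 / (1 - γ) ≤ CExtra T γ lam ξ := by rwa [div_le_iff₀' h0]
  have h3 : 0 ≤ -(lam / T) := by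
    rw [← neg_div]
    exact div_nonneg (by linarith) hT.le
  have h4 := mul_le_mul_of_nonneg_left h2 h3
  have h5 := h.CExtra_sq hW hT hl
  have h6 := le_sqrt_add_of_sq_le (a := lineNorm (deriv ξ)) (b := -(lam / (2 * T)))
    (C := CExtra T γ lam ξ) (by
      have : 2 * -(lam / (2 * T)) = -(lam / T) := by field_simp
      rw [this]
      linarith)
  have h7 : (-(lam / (2 * T))) ^ 2 = lam ^ 2 / (4 * T ^ 2) := by field_simp; norm_num
  rw [h7] at h6
  rw [CBase]
  linarith

/-- The zero here comes from λ ≥ 0 and not from n ≠ 0, so the bound needs no correction term when n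
= 0. -/
theorem CIntra_le_CBase (hW : 0 < W) (hT : 0 < T) (h : IsProlate W T n γ ξ)
    (hl : SolvesPSWEq W T lam ξ) (hlam : 0 ≤ lam) :
    CIntra T γ lam ξ ≤ CBase T lam ξ + lam / (2 * T) := by
  obtain ⟨z, hz, hz0⟩ := (h.1.isBandTimeEigen hW).exists_zero_of_nonneg hW hT h.1.1 hl hlam
  have h1 := h.sq_sub_sq_le_CIntra hW hT hl hz (t := T) (abs_of_pos hT).le
  rw [hz0] at h1
  have h2 : ξ T ^ 2 / γ ≤ CIntra T γ lam ξ := by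
    rw [div_le_iff₀' (h.gamma_pos hW hT)]
    linarith
  have h4 := mul_le_mul_of_nonneg_left h2 (div_nonneg hlam hT.le)
  have h5 := h.CIntra_sq hW hT hl
  have h6 := le_sqrt_add_of_sq_le (a := lineNorm (deriv ξ)) (b := lam / (2 * T))
    (C := CIntra T γ lam ξ) (by
      have : 2 * (lam / (2 * T)) = lam / T := by field_simp
      rw [this]
      linarith)
  have h7 : (lam / (2 * T)) ^ 2 = lam ^ 2 / (4 * T ^ 2) := by field_simp; norm_num
  rwa [h7] at h6

theorem CExtra_le_of_neg (hW : 0 < W) (hT : 0 < T) (h : IsProlate W T n γ ξ)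
    (hl : SolvesPSWEq W T lam ξ) (hlam : lam < 0) :
    CExtra T γ lam ξ ≤ W * (√(1 + (W * T) ^ 2 / 4) + W * T / 2) := by
  have h1 := (h.1.isBandTimeEigen hW).neg_lam_le hW hT h.1.1 h.1.2.2.1 hl
  have h2 := h.CExtra_le_CBase hW hT hl hlam
  have h3 : -(lam / (2 * T)) ≤ W * (W * T / 2) := by
    rw [← neg_div, div_le_iff₀ (by positivity)]
    linarith
  have h3' : 0 ≤ -(lam / (2 * T)) := by
    rw [← neg_div]
    exact div_nonneg (by linarith) (by positivity)
  have h4 : CBase T lam ξ ≤ W * √(1 + (W * T) ^ 2 / 4) := by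
    rw [CBase]
    refine Real.sqrt_le_iff.2 ⟨by positivity, ?_⟩
    rw [mul_pow, Real.sq_sqrt (by positivity)]
    have h5 := pow_le_pow_left₀ (lineNorm_nonneg _) (h.lineNorm_deriv_lt hW).le 2
    have h6 := pow_le_pow_left₀ h3' h3 2
    have h7 : (-(lam / (2 * T))) ^ 2 = lam ^ 2 / (4 * T ^ 2) := by field_simp; norm_num
    rw [h7] at h6
    linarith
  rw [mul_add]
  linarith

theorem CIntra_lt_of_neg (hW : 0 < W) (hT : 0 < T) (h : IsProlate W T n γ ξ)
    (hl : SolvesPSWEq W T lam ξ) (hlam : lam < 0) :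
    CIntra T γ lam ξ < lineNorm (deriv ξ) := by
  refine lt_of_pow_lt_pow_left₀ 2 (lineNorm_nonneg _) ?_
  rw [h.CIntra_sq hW hT hl]
  have h1 := (h.1.isBandTimeEigen hW).apply_ne_zero hT h.1.1 h.1.2.2.1
  have h2 : 0 < ξ T ^ 2 / γ := div_pos (by positivity) (h.gamma_pos hW hT)
  have h3 : lam / T < 0 := div_neg_of_neg_of_pos hlam hT
  linarith [mul_neg_of_neg_of_pos h3 h2]

theorem CExtra_le_of_nonneg (hW : 0 < W) (hT : 0 < T) (h : IsProlate W T n γ ξ)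
    (hl : SolvesPSWEq W T lam ξ) (hlam : 0 ≤ lam) :
    CExtra T γ lam ξ ≤ lineNorm (deriv ξ) := by
  refine le_of_sq_le_sq ?_ (lineNorm_nonneg _)
  rw [h.CExtra_sq hW hT hl]
  have h2 : 0 ≤ ξ T ^ 2 / (1 - γ) :=
    div_nonneg (sq_nonneg _) (sub_pos.2 (h.gamma_lt_one hW hT)).le
  linarith [mul_nonneg (div_nonneg hlam hT.le) h2]

end IsProlate

theorem sqrt_one_add_sq_div_le {c : ℝ} (hc : 0 < c) : √(1 + c ^ 2 / 4) ≤ c / 2 + 1 / c := by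
  refine Real.sqrt_le_iff.2 ⟨by positivity, ?_⟩
  have h1 : (c / 2 + 1 / c) ^ 2 = 1 + c ^ 2 / 4 + (1 / c) ^ 2 := by field_simp; ring
  rw [h1]
  linarith [sq_nonneg (1 / c)]

theorem mainTheorem1 :
    (∀ (W T : ℝ), 0 < W → 0 < T → ∀ (n : ℕ) (γ : ℝ) (ξ : ℝ → ℝ), IsProlate W T n γ ξ →
      -- all quantities below are well defined
      (0 < γ ∧ γ < 1) ∧ ContDiff ℝ ∞ ξ ∧ MemLp (deriv ξ) 2 volume ∧
      (∃! lam : ℝ, SolvesPSWEq W T lam ξ) ∧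
      lineNorm (deriv ξ) < W ∧
      ∀ lam : ℝ, SolvesPSWEq W T lam ξ →
        -- derivative energies
        energyInside T (deriv ξ) = γ * CIntra T γ lam ξ ^ 2 ∧
        energyOutside T (deriv ξ) = (1 - γ) * CExtra T γ lam ξ ^ 2 ∧
        -- supremum bounds
        (∀ t : ℝ, T ≤ |t| → ξ t ^ 2 ≤ (1 - γ) * CExtra T γ lam ξ) ∧
        (∀ t : ℝ, |t| ≤ T → ξ t ^ 2 ≤ γ * CIntraTilde T n γ lam ξ) ∧
        -- bounds for the constants
        (lam < 0 →
          CExtra T γ lam ξ ≤ CBase T lam ξ - lam / (2 * T) ∧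
          CExtra T γ lam ξ ≤ W * (Real.sqrt (1 + (W * T) ^ 2 / 4) + W * T / 2) ∧
          CIntra T γ lam ξ < lineNorm (deriv ξ) ∧
          CIntra T γ lam ξ < W) ∧
        (0 ≤ lam →
          CExtra T γ lam ξ ≤ lineNorm (deriv ξ) ∧
          CExtra T γ lam ξ < W ∧
          CIntra T γ lam ξ ≤ CBase T lam ξ + lam / (2 * T))) ∧
    -- large `c = W T`, uniformly in `W`, `T` and `n`
    (∃ K c₀ : ℝ, 0 < c₀ ∧ ∀ (W T : ℝ), 0 < W → 0 < T → c₀ ≤ W * T →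
      ∀ (n : ℕ) (γ : ℝ) (ξ : ℝ → ℝ) (lam : ℝ), IsProlate W T n γ ξ → SolvesPSWEq W T lam ξ →
        lam < 0 →
        CExtra T γ lam ξ < W * (W * T + 1 / (W * T) + K / (W * T) ^ 2)) := by
  -- The explicit bound is at most W(c + 1/c) for every c > 0; K = 1 serves to make the inequality
  -- strict.
  refine ⟨fun W T hW hT n γ ξ h => ?_, 1, 1, one_pos, fun W T hW hT _ n γ ξ lam h hl hlam => ?_⟩
  · have hE := h.1.isBandTimeEigen hW
    have hlt := h.lineNorm_deriv_lt hW
    refine ⟨⟨h.gamma_pos hW hT, h.gamma_lt_one hW hT⟩, hE.contDiff h.1.1,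
      hE.memLp_deriv hW h.1.1, h.existsUnique_solvesPSWEq hW hT, hlt, fun lam hl => ?_⟩
    refine ⟨?_, ?_, fun t ht => h.sq_le_CExtra hW hT hl ht,
      fun t ht => h.sq_le_CIntraTilde hW hT hl ht, fun hlam => ?_, fun hlam => ?_⟩
    · rw [h.energyInside_deriv_eq_mul hW hT hl, h.CIntra_sq hW hT hl]
    · rw [h.energyOutside_deriv_eq_mul hW hT hl, h.CExtra_sq hW hT hl]
    · have hin := h.CIntra_lt_of_neg hW hT hl hlam
      exact ⟨h.CExtra_le_CBase hW hT hl hlam, h.CExtra_le_of_neg hW hT hl hlam, hin, hin.trans hlt⟩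
    · have hex := h.CExtra_le_of_nonneg hW hT hl hlam
      exact ⟨hex, hex.trans_lt hlt, h.CIntra_le_CBase hW hT hl hlam⟩
  · have hc : 0 < W * T := mul_pos hW hT
    refine (h.CExtra_le_of_neg hW hT hl hlam).trans_lt (mul_lt_mul_of_pos_left ?_ hW)
    have h1 := sqrt_one_add_sq_div_le hc
    have h2 : 0 < 1 / (W * T) ^ 2 := by positivity
    linarith
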